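/- Let $F_2$ be the free group on $a,b$, let $\mathrm{Out}(F_2)=\mathrm{Aut}(F_2)/\mathrm{Inn}(F_2)$, and let $\ell$ be a prime. Write $\mathrm{Epi}(F_2,G)$ for the set of surjective homomorphisms $F_2\to G$. Let $N$ be the normalizer of $\mathrm{SL}_2(\mathbb F_\ell)$ in $\mathrm{SL}_2(\overline{\mathbb F}_\ell)$; it acts by conjugation on $\mathrm{SL}_2(\mathbb F_\ell)$ and hence on $\mathrm{PSL}_2(\mathbb F_\ell)$, the quotient of $\mathrm{SL}_2(\mathbb F_\ell)$ by its center. Put $$F(\ell)=\mathrm{Epi}(F_2,\mathrm{SL}_2(\mathbb F_\ell))/N,\qquad \overline{F(\ell)}=\mathrm{Epi}(F_2,\mathrm{PSL}_2(\mathbb F_\ell))/N$$ (equivalently, surjections modulo inner automorphisms, and then modulo $D(\ell)=N/\mathrm{SL}_2(\mathbb F_\ell)$). The group $\mathrm{Out}(F_2)$ acts on the right on both by $[\varphi]\cdot[\alpha]=[\varphi\circ\alpha]$. The trace invariant of $\varphi$ is $\mathrm{tr}(ABA^{-1}B^{-1})$, where $A,B\in\mathrm{SL}_2(\mathbb F_\ell)$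 equal (resp., for $\mathrm{PSL}_2$, are any lifts of) $\varphi(a),\varphi(b)$; let $F(\ell)_{-2}$ and $\overline{F(\ell)}_{-2}$ be the subsets of trace invariant $-2$. Let $X^*(\ell)$ be the set of $(x,y,z)\in\mathbb F_\ell^3\setminus\{(0,0,0)\}$ with $x^2+y^2+z^2-xyz=0$. Let $\mathcal V$ be the group acting on $\mathbb F_\ell^3$ by negating two of the coordinates (together with the identity), and let $Y^*(\ell)=X^*(\ell)/\mathcal V\subset \mathbb F_\ell^3/\mathcal V$. Let $\Gamma$ be the group of automorphisms of $\mathbb A^3$ (over $\mathbb Z$) generated by $R_3:(x,y,z)\mapsto(x,y,xy-z)$, $\tau_{12}:(x,y,z)\mapsto(y,x,z)$ and $\tau_{23}:(x,y,z)\mapsto(x,z,y)$; it acts on the left on $\mathbb F_\ell^3$ and on $\mathbb F_\ell^3/\mathcal V$. Define $$\mathrm{Tr}:F(\ell)\to\mathbb F_\ell^3,\ \ [\varphi]\mapsto(\mathrm{tr}\,\varphi(a),\mathrm{tr}\,\varphi(b),\mathrm{tr}\,\varphi(ab)),\qquad \overline{\mathrm{Tr}}:\overline{F(\ell)}\to\mathbb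 F_\ell^3/\mathcal V,\ \ [\varphi]\mapsto[\mathrm{tr}A,\mathrm{tr}B,\mathrm{tr}AB]$$ for any lifts $A,B$ of $\varphi(a),\varphi(b)$. **Proposition.** (0) For every prime $\ell\ge3$ these maps and the natural projections restrict to a commutative square with horizontal maps $\mathrm{Tr}:F(\ell)_{-2}\to X^*(\ell)$ and $\overline{\mathrm{Tr}}:\overline{F(\ell)}_{-2}\to Y^*(\ell)$, and vertical maps $F(\ell)_{-2}\to\overline{F(\ell)}_{-2}$ and $X^*(\ell)\to Y^*(\ell)$. (1) For every prime $\ell\ge3$ both horizontal maps are bijections, and every fiber of either vertical map has cardinality $4$. (2) $\mathrm{Out}(F_2)$ is generated by the classes of the automorphisms $r:(a,b)\mapsto(a^{-1},b)$, $s:(a,b)\mapsto(b,a)$ and $t:(a,b)\mapsto(a^{-1},ab)$. There is a surjective anti-homomorphism $\Theta:\mathrm{Out}(F_2)\to\Gamma$, independent of $\ell$, with $\Theta(r)=R_3$, $\Theta(s)=\tau_{12}$, $\Theta(t)=\tau_{23}$, such that for every prime $\ell\ge3$ the group $\Gamma$ preserves $X^*(\ell)$ and $Y^*(\ell)$, the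 group $\mathrm{Out}(F_2)$ preserves $F(\ell)_{-2}$ and $\overline{F(\ell)}_{-2}$, and $\mathrm{Tr}(c\cdot\alpha)=\Theta(\alpha)\,\mathrm{Tr}(c)$, $\overline{\mathrm{Tr}}(d\cdot\alpha)=\Theta(\alpha)\,\overline{\mathrm{Tr}}(d)$ for all $\alpha\in\mathrm{Out}(F_2)$, $c\in F(\ell)_{-2}$, $d\in\overline{F(\ell)}_{-2}$. (3) For $\ell=3$ the four sets $F(\ell)_{-2},\overline{F(\ell)}_{-2},X^*(\ell),Y^*(\ell)$ are all empty; for every prime $\ell\ge5$ they are all nonempty; for $\ell=2$ the sets $F(\ell)_{-2},\overline{F(\ell)}_{-2}$ are empty, while $X^*(\ell),Y^*(\ell)$ are not. -/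

import Mathlib

namespace MarkoffFiber

open MulOpposite
open scoped MatrixGroups RightActions

/-! ### The free group `F₂` and `Out(F₂)` -/

/-- The free group on two generators. -/
abbrev F2 : Type := FreeGroup (Fin 2)

/-- The first basis element. -/
def genA : F2 := FreeGroup.of 0

/-- The second basis element. -/
def genB : F2 := FreeGroup.of 1

instance innNormal (G : Type*) [Group G] : (MulAut.conj : G →* MulAut G).range.Normal where
  conj_mem := by
    rintro _ ⟨g, rfl⟩ σ
    refine ⟨σ g, ?_⟩
    ext x
    simp [MulAut.conj_apply, MulAut.mul_apply]

/-- The outer automorphism group `Out(F₂) = Aut(F₂)/Inn(F₂)`. -/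
abbrev OutF2 : Type := MulAut F2 ⧸ (MulAut.conj : F2 →* MulAut F2).range

/-- The endomorphism of `F₂` with `a ↦ u`, `b ↦ v`. -/
def endOf (u v : F2) : F2 →* F2 := FreeGroup.lift ![u, v]

/-- The automorphism `r : (a, b) ↦ (a⁻¹, b)`. -/
def autR : MulAut F2 :=
  MonoidHom.toMulEquiv (endOf genA⁻¹ genB) (endOf genA⁻¹ genB)
    (by ext i; fin_cases i <;> simp [endOf, genA, genB])
    (by ext i; fin_cases i <;> simp [endOf, genA, genB])

/-- The automorphism `s : (a, b) ↦ (b, a)`. -/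
def autS : MulAut F2 :=
  MonoidHom.toMulEquiv (endOf genB genA) (endOf genB genA)
    (by ext i; fin_cases i <;> simp [endOf, genA, genB])
    (by ext i; fin_cases i <;> simp [endOf, genA, genB])

/-- The automorphism `t : (a, b) ↦ (a⁻¹, ab)`. -/
def autT : MulAut F2 :=
  MonoidHom.toMulEquiv (endOf genA⁻¹ (genA * genB)) (endOf genA⁻¹ (genA * genB))
    (by ext i; fin_cases i <;> simp [endOf, genA, genB])
    (by ext i; fin_cases i <;> simp [endOf, genA, genB])

/-! ### Surjections `F₂ → G` modulo a group of automorphisms of `G` -/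

section Epi

variable {G : Type} [Group G]

/-- `Epi(F₂, G)`: the surjective homomorphisms `F₂ → G`. -/
abbrev Epi (G : Type) [Group G] : Type := {φ : F2 →* G // Function.Surjective φ}

/-- Two surjections are equivalent modulo `A ≤ Aut(G)` if they differ by postcomposition with an
element of `A`. -/
def epiSetoid (A : Subgroup (MulAut G)) : Setoid (Epi G) where
  r φ ψ := ∃ σ ∈ A, ∀ w, ψ.1 w = σ (φ.1 w)
  iseqv :=
    { refl := fun φ => ⟨1, A.one_mem, fun _ => rfl⟩
      symm := by
        rintro φ ψ ⟨σ, hσ, h⟩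
        exact ⟨σ⁻¹, A.inv_mem hσ, fun w => by rw [h w]; simp⟩
      trans := by
        rintro φ ψ χ ⟨σ, hσ, h⟩ ⟨τ, hτ, h'⟩
        exact ⟨τ * σ, A.mul_mem hτ hσ, fun w => by rw [h' w, h w]; rfl⟩ }

/-- The set `Epi(F₂, G)/A`. -/
def EpiQuot (A : Subgroup (MulAut G)) : Type := Quotient (epiSetoid A)

/-- The surjection `φ ∘ α`. -/
def Epi.precomp (φ : Epi G) (α : MulAut F2) : Epi G :=
  ⟨φ.1.comp α.toMonoidHom, φ.2.comp α.surjective⟩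

/-- If `A` contains all inner automorphisms of `G`, then `Out(F₂)` acts on `Epi(F₂, G)/A` from the
right by `[φ] · [α] = [φ ∘ α]`. -/
def EpiQuot.outSMul (A : Subgroup (MulAut G)) (hA : (MulAut.conj : G →* MulAut G).range ≤ A)
    (α : OutF2) (c : EpiQuot A) : EpiQuot A :=
  Quotient.liftOn₂ α c (fun β φ => (Quotient.mk (epiSetoid A) (Epi.precomp φ β) : EpiQuot A)) (by
    intro β φ β' φ' hβ hφ
    obtain ⟨σ, hσ, h⟩ := hφ
    obtain ⟨w, hw⟩ := QuotientGroup.leftRel_apply.mp hβ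
    have hw' : β' = β * MulAut.conj w := by rw [hw]; group
    refine Quotient.sound ⟨σ * MulAut.conj (φ.1 (β w)),
      A.mul_mem hσ (hA ⟨_, rfl⟩), fun v => ?_⟩
    change φ'.1 (β' v) = σ (MulAut.conj (φ.1 (β w)) (φ.1 (β v)))
    rw [h, hw']
    simp [MulAut.conj_apply, MulAut.mul_apply])

/-- The right action of `Out(F₂)` on `Epi(F₂, G)/A`. -/
@[reducible]
def EpiQuot.outAction (A : Subgroup (MulAut G))
    (hA : (MulAut.conj : G →* MulAut G).range ≤ A) : MulAction OutF2ᵐᵒᵖ (EpiQuot A) where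
  smul α c := EpiQuot.outSMul A hA (unop α) c
  one_smul c := by
    induction c using Quotient.inductionOn with
    | _ φ => rfl
  mul_smul α β c := by
    induction c using Quotient.inductionOn with
    | _ φ =>
      induction α using MulOpposite.rec' with
      | _ α =>
        induction β using MulOpposite.rec' with
        | _ β =>
          induction α using Quotient.inductionOn with
          | _ α =>
            induction β using Quotient.inductionOn with
            | _ β => rfl

end Epi

/-! ### `SL₂(𝔽_ℓ)`, `PSL₂(𝔽_ℓ)` and the normalizer of `SL₂(𝔽_ℓ)` -/

section Groups

variable (ℓ : ℕ) [Fact ℓ.Prime]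

/-- `SL₂(𝔽_ℓ)`. -/
abbrev SLl : Type := SL(2, ZMod ℓ)

/-- `PSL₂(𝔽_ℓ)`, the quotient of `SL₂(𝔽_ℓ)` by its centre. -/
abbrev PSLl : Type := PSL(2, ZMod ℓ)

/-- An algebraic closure of `𝔽_ℓ`. -/
abbrev Kbar : Type := AlgebraicClosure (ZMod ℓ)

/-- The inclusion of `SL₂(𝔽_ℓ)` in `SL₂` of the algebraic closure. -/
noncomputable def incl : SLl ℓ →* SL(2, Kbar ℓ) :=
  Matrix.SpecialLinearGroup.map (algebraMap (ZMod ℓ) (Kbar ℓ))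

theorem incl_injective : Function.Injective (incl ℓ) := by
  intro A B h
  ext i j
  have := congrArg (fun M : SL(2, Kbar ℓ) => M.1 i j) h
  exact (algebraMap (ZMod ℓ) (Kbar ℓ)).injective this

/-- The normalizer of `SL₂(𝔽_ℓ)` in `SL₂` of the algebraic closure. -/
noncomputable abbrev normSL : Subgroup SL(2, Kbar ℓ) :=
  Subgroup.normalizer ((incl ℓ).range : Set SL(2, Kbar ℓ))

/-- The conjugation action of the normalizer on `SL₂(𝔽_ℓ)`. -/
noncomputable def conjSL : normSL ℓ →* MulAut (SLl ℓ) :=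
  (MulAut.congr (MonoidHom.ofInjective (incl_injective ℓ)).symm).toMonoidHom.comp
    (Subgroup.normalizerMonoidHom (incl ℓ).range)

theorem incl_conjSL (g : normSL ℓ) (A : SLl ℓ) :
    incl ℓ (conjSL ℓ g A) = g.1 * incl ℓ A * g.1⁻¹ := by
  have h : MonoidHom.ofInjective (incl_injective ℓ) (conjSL ℓ g A) =
      Subgroup.normalizerMonoidHom (incl ℓ).range g
        (MonoidHom.ofInjective (incl_injective ℓ) A) := by
    simp only [conjSL, MulAut.congr, MonoidHom.comp_apply]
    exact (MonoidHom.ofInjective (incl_injective ℓ)).apply_symm_apply _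
  exact congrArg Subtype.val h

/-- The automorphism of `G/Z(G)` induced by an automorphism of `G`. -/
def autModCenter (G : Type) [Group G] : MulAut G →* MulAut (G ⧸ Subgroup.center G) where
  toFun σ := QuotientGroup.congr (Subgroup.center G) (Subgroup.center G) σ
    (Subgroup.characteristic_iff_map_eq.mp inferInstance σ)
  map_one' := by
    ext x
    induction x using QuotientGroup.induction_on with
    | _ x => rfl
  map_mul' σ τ := by
    ext x
    induction x using QuotientGroup.induction_on with
    | _ x => rfl

/-- The group of automorphisms of `SL₂(𝔽_ℓ)` given by conjugation by elements of the normalizer of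
`SL₂(𝔽_ℓ)`. As the normalizer contains `SL₂(𝔽_ℓ)`, dividing by it is the same as first dividing by
the inner automorphisms and then by `D(ℓ)`, the normalizer modulo `SL₂(𝔽_ℓ)`. -/
noncomputable def autSL : Subgroup (MulAut (SLl ℓ)) := (conjSL ℓ).range

/-- The induced group of automorphisms of `PSL₂(𝔽_ℓ)`. -/
noncomputable def autPSL : Subgroup (MulAut (PSLl ℓ)) := (autSL ℓ).map (autModCenter (SLl ℓ))

theorem inn_le_autSL : (MulAut.conj : SLl ℓ →* MulAut (SLl ℓ)).range ≤ autSL ℓ := by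
  rintro _ ⟨A, rfl⟩
  refine ⟨⟨incl ℓ A, Subgroup.le_normalizer ⟨A, rfl⟩⟩, ?_⟩
  ext1 B
  apply incl_injective ℓ
  rw [incl_conjSL]
  simp [MulAut.conj_apply]

theorem inn_le_autPSL : (MulAut.conj : PSLl ℓ →* MulAut (PSLl ℓ)).range ≤ autPSL ℓ := by
  rintro _ ⟨A, rfl⟩
  induction A using QuotientGroup.induction_on with
  | _ A =>
    refine ⟨MulAut.conj A, inn_le_autSL ℓ ⟨A, rfl⟩, ?_⟩
    ext1 B
    induction B using QuotientGroup.induction_on with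
    | _ B => rfl

/-- `F(ℓ) = Epi^ext(F₂, SL₂(𝔽_ℓ))/D(ℓ)`. -/
def FSL : Type := EpiQuot (autSL ℓ)

/-- `F̄(ℓ) = Epi^ext(F₂, PSL₂(𝔽_ℓ))/D(ℓ)`. -/
def FPSL : Type := EpiQuot (autPSL ℓ)

noncomputable instance : MulAction OutF2ᵐᵒᵖ (FSL ℓ) :=
  EpiQuot.outAction (autSL ℓ) (inn_le_autSL ℓ)

noncomputable instance : MulAction OutF2ᵐᵒᵖ (FPSL ℓ) :=
  EpiQuot.outAction (autPSL ℓ) (inn_le_autPSL ℓ)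

/-- The class in `F(ℓ)` of a surjection. -/
noncomputable def FSL.mk (φ : Epi (SLl ℓ)) : FSL ℓ := Quotient.mk (epiSetoid (autSL ℓ)) φ

/-- The class in `F̄(ℓ)` of a surjection. -/
noncomputable def FPSL.mk (φ : Epi (PSLl ℓ)) : FPSL ℓ := Quotient.mk (epiSetoid (autPSL ℓ)) φ

/-- The composite of a surjection onto `SL₂(𝔽_ℓ)` with the projection to `PSL₂(𝔽_ℓ)`. -/
def projEpi (φ : Epi (SLl ℓ)) : Epi (PSLl ℓ) :=
  ⟨(QuotientGroup.mk' _).comp φ.1, (QuotientGroup.mk'_surjective _).comp φ.2⟩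

/-- The vertical map `F(ℓ) → F̄(ℓ)`. -/
noncomputable def projF : FSL ℓ → FPSL ℓ :=
  Quotient.lift (fun φ => FPSL.mk ℓ (projEpi ℓ φ)) (by
    rintro φ ψ ⟨σ, hσ, h⟩
    refine Quotient.sound ⟨autModCenter _ σ, ⟨σ, hσ, rfl⟩, fun w => ?_⟩
    change ((ψ.1 w : SLl ℓ) : PSLl ℓ) = ((σ (φ.1 w) : SLl ℓ) : PSLl ℓ)
    rw [h w])

/-! ### Affine three-space over `𝔽_ℓ`, its quotient by `𝒱`, and the Markoff surface -/

/-- `(x, y, z)` and its images under negating two of the coordinates are equivalent. -/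
def VRel (p q : Fin 3 → ZMod ℓ) : Prop :=
  q = p ∨ q = ![p 0, -p 1, -p 2] ∨ q = ![-p 0, p 1, -p 2] ∨ q = ![-p 0, -p 1, p 2]

theorem vRel_iff (p q : Fin 3 → ZMod ℓ) : VRel ℓ p q ↔
    (q 0 = p 0 ∧ q 1 = p 1 ∧ q 2 = p 2) ∨ (q 0 = p 0 ∧ q 1 = -p 1 ∧ q 2 = -p 2) ∨
    (q 0 = -p 0 ∧ q 1 = p 1 ∧ q 2 = -p 2) ∨ (q 0 = -p 0 ∧ q 1 = -p 1 ∧ q 2 = p 2) := by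
  simp [VRel, funext_iff, Fin.forall_fin_succ]

/-- The relation of lying in the same orbit of the group `𝒱`. -/
def vSetoid : Setoid (Fin 3 → ZMod ℓ) where
  r := VRel ℓ
  iseqv :=
    { refl := fun p => Or.inl rfl
      symm := by
        intro p q h
        rw [vRel_iff] at h ⊢
        grind
      trans := by
        intro p q r h h'
        rw [vRel_iff] at h h' ⊢
        grind }

/-- `𝔽_ℓ³/𝒱`. -/
def VQuot : Type := Quotient (vSetoid ℓ)

/-- The `𝒱`-orbit `[x, y, z]`. -/
def VQuot.mk (p : Fin 3 → ZMod ℓ) : VQuot ℓ := Quotient.mk (vSetoid ℓ) p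

/-- `X*(ℓ)`: the nonzero solutions of `x² + y² + z² - xyz = 0` in `𝔽_ℓ³`. -/
def XStar : Set (Fin 3 → ZMod ℓ) :=
  {p | p 0 ^ 2 + p 1 ^ 2 + p 2 ^ 2 - p 0 * p 1 * p 2 = 0 ∧ p ≠ 0}

/-- `Y*(ℓ) = X*(ℓ)/𝒱`, as a subset of `𝔽_ℓ³/𝒱`. -/
def YStar : Set (VQuot ℓ) := VQuot.mk ℓ '' XStar ℓ

/-! ### Trace maps and trace invariants -/

/-- The triple `(tr A, tr B, tr AB)`. -/
def trTriple (A B : SLl ℓ) : Fin 3 → ZMod ℓ :=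
  ![A.1.trace, B.1.trace, (A * B).1.trace]

theorem trace_conjSL (σ : MulAut (SLl ℓ)) (hσ : σ ∈ autSL ℓ) (A : SLl ℓ) :
    (σ A).1.trace = A.1.trace := by
  obtain ⟨g, rfl⟩ := hσ
  have key : ∀ B : SLl ℓ, (incl ℓ B).1.trace = algebraMap (ZMod ℓ) (Kbar ℓ) B.1.trace := by
    intro B
    simp [incl, Matrix.trace_fin_two]
  apply (algebraMap (ZMod ℓ) (Kbar ℓ)).injective
  rw [← key, ← key, incl_conjSL]
  rw [Matrix.SpecialLinearGroup.coe_mul, Matrix.trace_mul_comm,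
    ← Matrix.SpecialLinearGroup.coe_mul, inv_mul_cancel_left]

theorem sign_of_center (A A' : SLl ℓ) (h : (A : PSLl ℓ) = (A' : PSLl ℓ)) :
    A'.1 = A.1 ∨ A'.1 = -A.1 := by
  obtain ⟨r, hr, hA⟩ :=
    Matrix.SpecialLinearGroup.mem_center_iff.mp (QuotientGroup.eq.mp h)
  have h1 : A'.1 = r • A.1 := by
    have h2 : A' = A * (A⁻¹ * A') := by group
    have h3 := congrArg Subtype.val h2
    rw [Matrix.SpecialLinearGroup.coe_mul A] at h3
    rw [h3]
    change A.1 * (A⁻¹ * A').1 = _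
    rw [← hA, Matrix.scalar_apply, ← Matrix.smul_one_eq_diagonal, Matrix.mul_smul, mul_one]
  have h4 : r ^ 2 = 1 := by simpa using hr
  rcases sq_eq_one_iff.mp h4 with h | h
  · left; simpa [h] using h1
  · right; simpa [h] using h1

/-- The `𝔽_ℓ³/𝒱`-valued trace triple of a pair in `PSL₂(𝔽_ℓ)`, computed from any lifts. -/
def trTripleBar (x y : PSLl ℓ) : VQuot ℓ :=
  Quotient.liftOn₂ x y (fun A B => VQuot.mk ℓ (trTriple ℓ A B)) (by
    intro A B A' B' hA hB
    refine Quotient.sound ?_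
    change VRel ℓ _ _
    rw [vRel_iff]
    rcases sign_of_center ℓ A A' (Quotient.sound hA) with h | h <;>
      rcases sign_of_center ℓ B B' (Quotient.sound hB) with h' | h' <;>
      simp [trTriple, h, h'])

/-- The trace of the commutator of a pair in `PSL₂(𝔽_ℓ)`, computed from any lifts. -/
def trCommBar (x y : PSLl ℓ) : ZMod ℓ :=
  Quotient.liftOn₂ x y (fun A B => (A * B * A⁻¹ * B⁻¹).1.trace) (by
    intro A B A' B' hA hB
    rcases sign_of_center ℓ A A' (Quotient.sound hA) with h | h <;>
      rcases sign_of_center ℓ B B' (Quotient.sound hB) with h' | h' <;>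
      simp [Matrix.SpecialLinearGroup.coe_inv, h, h',
        Matrix.adjugate_fin_two, Matrix.trace_fin_two, Matrix.mul_apply, Fin.sum_univ_two] <;> ring)

theorem trTripleBar_mk (A B : SLl ℓ) :
    trTripleBar ℓ (A : PSLl ℓ) (B : PSLl ℓ) = VQuot.mk ℓ (trTriple ℓ A B) := rfl

theorem trCommBar_mk (A B : SLl ℓ) :
    trCommBar ℓ (A : PSLl ℓ) (B : PSLl ℓ) = (A * B * A⁻¹ * B⁻¹).1.trace := rfl

/-- `Tr : F(ℓ) → 𝔽_ℓ³`, induced by `φ ↦ (tr φ(a), tr φ(b), tr φ(ab))`. -/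
noncomputable def Tr : FSL ℓ → Fin 3 → ZMod ℓ :=
  Quotient.lift
    (fun φ => ![(φ.1 genA).1.trace, (φ.1 genB).1.trace, (φ.1 (genA * genB)).1.trace]) (by
      rintro φ ψ ⟨σ, hσ, h⟩
      simp only [h, trace_conjSL ℓ σ hσ])

/-- `Tr̄ : F̄(ℓ) → 𝔽_ℓ³/𝒱`, induced by `φ ↦ [tr A, tr B, tr AB]` for any lifts `A, B` of
`φ(a), φ(b)`. -/
noncomputable def TrBar : FPSL ℓ → VQuot ℓ :=
  Quotient.lift (fun φ => trTripleBar ℓ (φ.1 genA) (φ.1 genB)) (by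
    rintro φ ψ ⟨_, ⟨σ, hσ, rfl⟩, h⟩
    simp only [h]
    generalize φ.1 genA = x
    generalize φ.1 genB = y
    induction x using QuotientGroup.induction_on with
    | _ A =>
      induction y using QuotientGroup.induction_on with
      | _ B =>
        change VQuot.mk ℓ (trTriple ℓ A B) = VQuot.mk ℓ (trTriple ℓ (σ A) (σ B))
        simp only [trTriple, ← map_mul, trace_conjSL ℓ σ hσ])

/-- The trace invariant `tr [φ(a), φ(b)]` on `F(ℓ)`. -/
noncomputable def trInv : FSL ℓ → ZMod ℓ :=
  Quotient.lift (fun φ => (φ.1 genA * φ.1 genB * (φ.1 genA)⁻¹ * (φ.1 genB)⁻¹).1.trace) (by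
    rintro φ ψ ⟨σ, hσ, h⟩
    simp only [h, ← map_mul, ← map_inv, trace_conjSL ℓ σ hσ])

/-- The trace invariant `tr [A, B]` on `F̄(ℓ)`, where `A, B` are any lifts of `φ(a), φ(b)`. -/
noncomputable def trInvBar : FPSL ℓ → ZMod ℓ :=
  Quotient.lift (fun φ => trCommBar ℓ (φ.1 genA) (φ.1 genB)) (by
    rintro φ ψ ⟨_, ⟨σ, hσ, rfl⟩, h⟩
    simp only [h]
    generalize φ.1 genA = x
    generalize φ.1 genB = y
    induction x using QuotientGroup.induction_on with
    | _ A =>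
      induction y using QuotientGroup.induction_on with
      | _ B =>
        change (A * B * A⁻¹ * B⁻¹).1.trace = (σ A * σ B * (σ A)⁻¹ * (σ B)⁻¹).1.trace
        simp only [← map_mul, ← map_inv, trace_conjSL ℓ σ hσ])

/-- `F(ℓ)_{-2}`: the classes of trace invariant `-2`. -/
def FSLm2 : Set (FSL ℓ) := {c | trInv ℓ c = -2}

/-- `F̄(ℓ)_{-2}`: the classes of trace invariant `-2`. -/
def FPSLm2 : Set (FPSL ℓ) := {c | trInvBar ℓ c = -2}

end Groups

/-! ### Automorphisms of affine three-space and the Markoff group -/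

/-- The automorphism group of `𝔸³` over `ℤ`, which is opposite to the automorphism group of its
coordinate ring. -/
def AffineAut : Type := (MvPolynomial (Fin 3) ℤ ≃ₐ[ℤ] MvPolynomial (Fin 3) ℤ)ᵐᵒᵖ

noncomputable instance : Group AffineAut :=
  inferInstanceAs (Group (MvPolynomial (Fin 3) ℤ ≃ₐ[ℤ] MvPolynomial (Fin 3) ℤ)ᵐᵒᵖ)

/-- The automorphism with given comorphism. -/
def AffineAut.of (f : MvPolynomial (Fin 3) ℤ ≃ₐ[ℤ] MvPolynomial (Fin 3) ℤ) : AffineAut := op f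

/-- The comorphism on coordinate rings. -/
def AffineAut.comorphism (f : AffineAut) : MvPolynomial (Fin 3) ℤ ≃ₐ[ℤ] MvPolynomial (Fin 3) ℤ :=
  unop f

section Points

variable {R : Type} [CommRing R]

/-- The left action of `Aut(𝔸³)` on `𝔸³(R) = R³`: the coordinate polynomials are evaluated. -/
noncomputable instance : MulAction AffineAut (Fin 3 → R) where
  smul f p i := MvPolynomial.aeval p (f.comorphism (MvPolynomial.X i))
  one_smul p := by
    funext i
    exact MvPolynomial.aeval_X p i
  mul_smul f g p := by
    funext i
    have h : ∀ P : MvPolynomial (Fin 3) ℤ,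
        MvPolynomial.aeval p (g.comorphism P) =
          MvPolynomial.aeval (fun j => MvPolynomial.aeval p (g.comorphism (MvPolynomial.X j))) P := by
      intro P
      have : ((MvPolynomial.aeval p).comp (g.comorphism : _ →ₐ[ℤ] _) :
          MvPolynomial (Fin 3) ℤ →ₐ[ℤ] R) = MvPolynomial.aeval
            (fun j => MvPolynomial.aeval p (g.comorphism (MvPolynomial.X j))) := by
        ext j
        simp
      exact DFunLike.congr_fun this P
    exact h _

theorem smul_apply (f : AffineAut) (p : Fin 3 → R) (i : Fin 3) :
    (f • p) i = MvPolynomial.aeval p (f.comorphism (MvPolynomial.X i)) := rfl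

end Points

/-- The automorphism of `𝔸³` with the given coordinate polynomials, required to be an
involution. -/
noncomputable def AffineAut.ofInvol (P : Fin 3 → MvPolynomial (Fin 3) ℤ)
    (h : ∀ i, MvPolynomial.aeval P (P i) = MvPolynomial.X i) : AffineAut :=
  AffineAut.of (AlgEquiv.ofAlgHom (MvPolynomial.aeval P) (MvPolynomial.aeval P)
    (by ext1 i; simpa [MvPolynomial.aeval_eq_bind₁] using h i)
    (by ext1 i; simpa [MvPolynomial.aeval_eq_bind₁] using h i))

theorem AffineAut.ofInvol_smul {R : Type} [CommRing R] (P : Fin 3 → MvPolynomial (Fin 3) ℤ)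
    (h : ∀ i, MvPolynomial.aeval P (P i) = MvPolynomial.X i) (p : Fin 3 → R) (i : Fin 3) :
    (AffineAut.ofInvol P h • p) i = MvPolynomial.aeval p (P i) := by
  rw [smul_apply]
  simp [AffineAut.ofInvol, AffineAut.of, AffineAut.comorphism]

/-- The Vieta involution `R₃ : (x, y, z) ↦ (x, y, xy - z)`. -/
noncomputable def R3 : AffineAut :=
  AffineAut.ofInvol
    ![MvPolynomial.X 0, MvPolynomial.X 1,
      MvPolynomial.X 0 * MvPolynomial.X 1 - MvPolynomial.X 2]
    (by intro i; fin_cases i <;> simp)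

/-- `τ₁₂ : (x, y, z) ↦ (y, x, z)`. -/
noncomputable def tau12 : AffineAut :=
  AffineAut.ofInvol ![MvPolynomial.X 1, MvPolynomial.X 0, MvPolynomial.X 2]
    (by intro i; fin_cases i <;> simp)

/-- `τ₂₃ : (x, y, z) ↦ (x, z, y)`. -/
noncomputable def tau23 : AffineAut :=
  AffineAut.ofInvol ![MvPolynomial.X 0, MvPolynomial.X 2, MvPolynomial.X 1]
    (by intro i; fin_cases i <;> simp)

theorem R3_smul {R : Type} [CommRing R] (p : Fin 3 → R) :
    R3 • p = ![p 0, p 1, p 0 * p 1 - p 2] := by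
  funext i
  rw [R3, AffineAut.ofInvol_smul]
  fin_cases i <;> simp

theorem tau12_smul {R : Type} [CommRing R] (p : Fin 3 → R) :
    tau12 • p = ![p 1, p 0, p 2] := by
  funext i
  rw [tau12, AffineAut.ofInvol_smul]
  fin_cases i <;> simp

theorem tau23_smul {R : Type} [CommRing R] (p : Fin 3 → R) :
    tau23 • p = ![p 0, p 2, p 1] := by
  funext i
  rw [tau23, AffineAut.ofInvol_smul]
  fin_cases i <;> simp

/-- The Markoff group `Γ`, generated by `R₃`, `τ₁₂` and `τ₂₃` in `Aut(𝔸³)`. -/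
noncomputable def Gam : Subgroup AffineAut := Subgroup.closure {R3, tau12, tau23}

theorem R3_mem : R3 ∈ Gam := Subgroup.subset_closure (by simp)

theorem tau12_mem : tau12 ∈ Gam := Subgroup.subset_closure (by simp)

theorem tau23_mem : tau23 ∈ Gam := Subgroup.subset_closure (by simp)

section Quot

variable (ℓ : ℕ) [Fact ℓ.Prime]

theorem vRel_smul_iff (γ : AffineAut) (hγ : γ ∈ Gam) :
    ∀ p q : Fin 3 → ZMod ℓ, VRel ℓ (γ • p) (γ • q) ↔ VRel ℓ p q := by
  induction hγ using Subgroup.closure_induction with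
  | mem γ h =>
    intro p q
    rcases h with rfl | rfl | rfl
    · rw [R3_smul, R3_smul, vRel_iff, vRel_iff]
      simp only [Matrix.cons_val]
      grind
    · rw [tau12_smul, tau12_smul, vRel_iff, vRel_iff]
      simp only [Matrix.cons_val]
      grind
    · rw [tau23_smul, tau23_smul, vRel_iff, vRel_iff]
      simp only [Matrix.cons_val]
      grind
  | one => intro p q; simp
  | mul γ δ _ _ h h' => intro p q; rw [mul_smul, mul_smul, h, h']
  | inv γ _ h => intro p q; rw [← h]; simp

/-- The action of `Γ` on `𝔽_ℓ³/𝒱` induced by its action on `𝔽_ℓ³`. -/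
noncomputable instance : MulAction Gam (VQuot ℓ) where
  smul γ := Quotient.map (sa := vSetoid ℓ) (sb := vSetoid ℓ) (fun p => γ.1 • p)
    (fun p q h => (vRel_smul_iff ℓ γ.1 γ.2 p q).mpr h)
  one_smul c := by
    induction c using Quotient.inductionOn with
    | _ p => exact congrArg (VQuot.mk ℓ) (one_smul AffineAut p)
  mul_smul γ δ c := by
    induction c using Quotient.inductionOn with
    | _ p => exact congrArg (VQuot.mk ℓ) (mul_smul γ.1 δ.1 p)

theorem smul_vQuot_mk (γ : Gam) (p : Fin 3 → ZMod ℓ) :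
    γ • VQuot.mk ℓ p = VQuot.mk ℓ (γ • p) := rfl

end Quot

end MarkoffFiber

open MarkoffFiber MulOpposite
open scoped RightActions

/-! Write `x, y, z` for the traces of `A, B, AB`. Fricke's identity makes commutator trace `-2` the
same condition as the Markoff equation. The polarised Cayley–Hamilton identity shows that `x = y = z
= 0` forces `AB = -BA`, so the images in the nonabelian group `PSL₂` commute; surjections therefore
land in `X*`.

Commutator trace `-2` also says that `AB + BA` is singular. For a kernel vector `v`, the pair `v,
Av` is a basis (for `ℓ` odd), and when `x ≠ 0` both matrices in this basis depend only on `(x, y,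
z)` (`exists_conj_normalForm`). Equal triples are thus conjugate under `GL₂(𝔽_ℓ)`, hence under the
normalizer after scaling by a square root of the determinant: this is injectivity. A Markoff point
has at most one zero coordinate, so `x ≠ 0` up to swapping `A` and `B`. The normal form exists over
each such point and generates `SL₂(𝔽_ℓ)`, because its commutator is minus a nontrivial unipotent
(`closure_normalForm`): this is surjectivity. The `PSL₂` statement follows by adjusting signs of
lifts, and the fibers have four elements because `𝒱` acts freely on `X*`.

Generation of `Out(F₂)` is Nielsen's argument (`NielsenPair.all`): a basis image of positive excess
length is shortened by a Nielsen move or by a conjugation, and otherwise cancellation is so limited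
that word length cannot drop, which leaves only letters.

For `Θ`, each automorphism of `F₂` acts on traces of `SL₂` representations over every commutative
ring by an element of `Γ`. That element is unique because every triple in `ℂ³` is a trace triple,
and precomposition reverses products. Equivariance is this identity over `𝔽_ℓ`. -/

/-! ### Pairs in `SL₂` with given traces -/

namespace MarkoffFiber

open scoped MatrixGroups

/-! ### Trace identities and standard matrices in `SL₂`. -/

section Identities

variable {R : Type*} [CommRing R]

/-- Fricke's identity for the trace of a commutator. -/
theorem trace_commutator (A B : SL(2, R)) :
    (A * B * A⁻¹ * B⁻¹).1.trace =
      A.1.trace ^ 2 + B.1.trace ^ 2 + (A * B).1.trace ^ 2 -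
        A.1.trace * B.1.trace * (A * B).1.trace - 2 := by
  have hA := A.2
  have hB := B.2
  rw [Matrix.det_fin_two] at hA hB
  simp only [Matrix.SpecialLinearGroup.coe_mul, Matrix.SpecialLinearGroup.coe_inv,
    Matrix.adjugate_fin_two, Matrix.trace_fin_two, Matrix.mul_apply, Fin.sum_univ_two,
    Matrix.of_apply, Matrix.cons_val_zero, Matrix.cons_val_one, Matrix.cons_val']
  generalize A.1 0 0 = a at *
  generalize A.1 0 1 = b at *
  generalize A.1 1 0 = c at *
  generalize A.1 1 1 = d at *
  generalize B.1 0 0 = e at *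
  generalize B.1 0 1 = f at *
  generalize B.1 1 0 = g at *
  generalize B.1 1 1 = h at *
  linear_combination ((e + h) ^ 2 - 2 * (e * h - f * g)) * hA + ((a + d) ^ 2 - 2) * hB

/-- This is the polarisation of the Cayley–Hamilton theorem. It expresses `B v` through `v` and `A
v` once `(AB + BA) v = 0`. -/
theorem mul_add_mul_eq (A B : Matrix (Fin 2) (Fin 2) R) :
    A * B + B * A = B.trace • A + A.trace • B + ((A * B).trace - A.trace * B.trace) • 1 := by
  ext i j
  fin_cases i <;> fin_cases j <;>
    simp [Matrix.mul_apply, Fin.sum_univ_two, Matrix.trace_fin_two] <;> ring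

/-- Turns the trace condition `-2` into the existence of a nonzero `v` with `ABv = -BAv`. -/
theorem det_mul_add_mul (A B : SL(2, R)) :
    (A.1 * B.1 + B.1 * A.1).det = (A * B * A⁻¹ * B⁻¹).1.trace + 2 := by
  have hA := A.2
  have hB := B.2
  rw [Matrix.det_fin_two] at hA hB
  simp only [Matrix.SpecialLinearGroup.coe_mul, Matrix.SpecialLinearGroup.coe_inv,
    Matrix.adjugate_fin_two, Matrix.trace_fin_two, Matrix.mul_apply, Fin.sum_univ_two,
    Matrix.of_apply, Matrix.cons_val_zero, Matrix.cons_val_one, Matrix.cons_val',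
    Matrix.det_fin_two, Matrix.add_apply]
  generalize A.1 0 0 = a at *
  generalize A.1 0 1 = b at *
  generalize A.1 1 0 = c at *
  generalize A.1 1 1 = d at *
  generalize B.1 0 0 = e at *
  generalize B.1 0 1 = f at *
  generalize B.1 1 0 = g at *
  generalize B.1 1 1 = h at *
  linear_combination (2 * (e * h - f * g)) * hA + 2 * hB

/-- An upper unitriangular matrix. -/
def upperUni (t : R) : SL(2, R) := ⟨!![1, t; 0, 1], by simp⟩

/-- A lower unitriangular matrix. -/
def lowerUni (t : R) : SL(2, R) := ⟨!![1, 0; t, 1], by simp⟩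

@[simp]
theorem coe_upperUni (t : R) : (upperUni t).1 = !![1, t; 0, 1] := rfl

@[simp]
theorem coe_lowerUni (t : R) : (lowerUni t).1 = !![1, 0; t, 1] := rfl

theorem upperUni_pow (t : R) (n : ℕ) : upperUni t ^ n = upperUni (n * t) := by
  induction n with
  | zero =>
    ext i j
    fin_cases i <;> fin_cases j <;> simp
  | succ n ih =>
    rw [pow_succ, ih]
    ext i j
    fin_cases i <;> fin_cases j <;> simp
    ring

/-- The companion matrix of `T² - xT + 1`. -/
def companion (x : R) : SL(2, R) := ⟨!![0, -1; 1, x], by simp⟩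

@[simp]
theorem coe_companion (x : R) : (companion x).1 = !![0, -1; 1, x] := rfl

/-- The second member of the normal form of a pair with commutator trace `-2`. -/
def companionMate (x r s : R) (h : r ^ 2 + s ^ 2 + x * r * s = -1) : SL(2, R) :=
  ⟨!![-s - x * r, r; r, s], by rw [Matrix.det_fin_two_of]; linear_combination -h⟩

@[simp]
theorem coe_companionMate (x r s : R) (h : r ^ 2 + s ^ 2 + x * r * s = -1) :
    (companionMate x r s h).1 = !![-s - x * r, r; r, s] := rfl

end Identities

/-! ### Generation by unipotents and the normal form over a field. -/

section Field

variable {F : Type*} [Field F]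

/-- A matrix with nonzero lower left entry factors as upper times lower times upper unipotent;
multiplying by `lowerUni 1` reduces the triangular case to this one. -/
theorem subgroup_eq_top_of_uni (H : Subgroup SL(2, F)) (hU : ∀ t, upperUni t ∈ H)
    (hL : ∀ t, lowerUni t ∈ H) : H = ⊤ := by
  have key : ∀ A : SL(2, F), A.1 1 0 ≠ 0 → A ∈ H := by
    intro A h
    have hA := A.2
    rw [Matrix.det_fin_two] at hA
    have : A = upperUni ((A.1 0 0 - 1) / A.1 1 0) * lowerUni (A.1 1 0) *
        upperUni ((A.1 1 1 - 1) / A.1 1 0) := by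
      ext i j
      fin_cases i <;> fin_cases j <;> simp [Matrix.mul_apply, Fin.sum_univ_two] <;> field_simp
      · ring
      · linear_combination -hA
      · ring
    rw [this]
    exact H.mul_mem (H.mul_mem (hU _) (hL _)) (hU _)
  rw [eq_top_iff]
  rintro A -
  by_cases h : A.1 1 0 = 0
  · have hA := A.2
    rw [Matrix.det_fin_two, h, mul_zero, sub_zero] at hA
    refine (H.mul_mem_cancel_left (hL 1)).mp (key _ ?_)
    have : (lowerUni 1 * A).1 1 0 = A.1 0 0 := by
      simp [Matrix.mul_apply, Fin.sum_univ_two, h]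
    rw [this]
    exact left_ne_zero_of_mul_eq_one hA
  · exact key A h

theorem exists_smul_of_mul_eq_mul {v w : Fin 2 → F} (hv : v ≠ 0) (h : v 0 * w 1 = v 1 * w 0) :
    ∃ c : F, w = c • v := by
  by_cases h0 : v 0 = 0
  · have h1 : v 1 ≠ 0 := by
      intro h1
      apply hv
      ext i
      fin_cases i
      · exact h0
      · exact h1
    refine ⟨w 1 / v 1, ?_⟩
    ext i
    fin_cases i <;> simp
    · rw [h0, zero_mul] at h
      rw [h0, mul_zero]
      exact (mul_eq_zero.mp h.symm).resolve_left h1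
    · field_simp
  · refine ⟨w 0 / v 0, ?_⟩
    ext i
    fin_cases i <;> simp
    · field_simp
    · field_simp
      linear_combination h

open Matrix in
/-- A pair in `SL₂` with commutator trace `-2` whose first member has nonzero trace is conjugate to
a normal form that depends only on the traces. -/
theorem exists_conj_normalForm (h2 : (2 : F) ≠ 0) (A B : SL(2, F))
    (hc : (A * B * A⁻¹ * B⁻¹).1.trace = -2) (hx : A.1.trace ≠ 0) {r s : F}
    (hr : A.1.trace * r = -B.1.trace) (hs : A.1.trace * s = (A * B).1.trace)
    (hrs : r ^ 2 + s ^ 2 + A.1.trace * r * s = -1) :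
    ∃ P : GL (Fin 2) F, P.1 * (companion A.1.trace).1 = A.1 * P.1 ∧
      P.1 * (companionMate A.1.trace r s hrs).1 = B.1 * P.1 := by
  obtain ⟨v, hv, hv0⟩ := Matrix.exists_mulVec_eq_zero_iff.mpr
    (show (A.1 * B.1 + B.1 * A.1).det = 0 by rw [det_mul_add_mul, hc]; ring)
  have hBA : B.1 *ᵥ (A.1 *ᵥ v) = -(A.1 *ᵥ (B.1 *ᵥ v)) := by
    rw [Matrix.add_mulVec, ← Matrix.mulVec_mulVec, ← Matrix.mulVec_mulVec] at hv0
    exact (neg_eq_of_add_eq_zero_right hv0).symm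
  have hAA : A.1 *ᵥ (A.1 *ᵥ v) = A.1.trace • (A.1 *ᵥ v) - v := by
    have hA := A.2
    rw [Matrix.det_fin_two] at hA
    ext i
    fin_cases i <;>
      simp only [Matrix.mulVec, dotProduct, Fin.sum_univ_two, Matrix.trace_fin_two, Pi.sub_apply,
        Pi.smul_apply, smul_eq_mul, Fin.zero_eta, Fin.mk_one]
    · linear_combination -v 0 * hA
    · linear_combination -v 1 * hA
  -- Apply the polarised identity to `v` and divide by `tr A`; only here is `tr A ≠ 0` needed.
  have hB : B.1 *ᵥ v = (-s - A.1.trace * r) • v + r • (A.1 *ᵥ v) := by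
    rw [mul_add_mul_eq, Matrix.add_mulVec, Matrix.add_mulVec, Matrix.smul_mulVec,
      Matrix.smul_mulVec, Matrix.smul_mulVec, Matrix.one_mulVec,
      ← Matrix.SpecialLinearGroup.coe_mul, ← hs] at hv0
    ext i
    have := congrFun hv0 i
    simp only [Pi.add_apply, Pi.smul_apply, smul_eq_mul, Pi.zero_apply] at this ⊢
    apply mul_left_cancel₀ hx
    linear_combination this + (A.1.trace * v i - (A.1 *ᵥ v) i) * hr
  have hBA' : B.1 *ᵥ (A.1 *ᵥ v) = r • v + s • (A.1 *ᵥ v) := by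
    rw [hBA, hB, Matrix.mulVec_add, Matrix.mulVec_smul, Matrix.mulVec_smul, hAA]
    module
  have inj : ∀ {C : SL(2, F)} {u : Fin 2 → F}, C.1 *ᵥ u = 0 → u = 0 := by
    intro C u hu
    have : C⁻¹.1 *ᵥ (C.1 *ᵥ u) = u := by
      rw [Matrix.mulVec_mulVec, ← Matrix.SpecialLinearGroup.coe_mul, inv_mul_cancel,
        Matrix.SpecialLinearGroup.coe_one, Matrix.one_mulVec]
    rw [← this, hu, Matrix.mulVec_zero]
  -- If `Av = cv`, then `Bv = bv` for some `b`, and `BAv = -ABv` gives `2cb = 0`, contradicting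
  -- invertibility of `A` or `B`.
  have hdet : (!![v 0, (A.1 *ᵥ v) 0; v 1, (A.1 *ᵥ v) 1]).det ≠ 0 := by
    intro h
    rw [Matrix.det_fin_two_of] at h
    obtain ⟨c, hcv⟩ := exists_smul_of_mul_eq_mul (w := A.1 *ᵥ v) hv (by linear_combination h)
    rw [hcv] at hB
    rw [hB] at hBA
    have e1 : B.1 *ᵥ v = ((-s - A.1.trace * r) + r * c) • v := by rw [hB]; module
    rw [hcv, Matrix.mulVec_smul, Matrix.mulVec_add, Matrix.mulVec_smul, Matrix.mulVec_smul,
      Matrix.mulVec_smul, hcv, e1] at hBA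
    have e2 : (2 * c * ((-s - A.1.trace * r) + r * c)) • v = 0 := by
      rw [← sub_eq_zero] at hBA
      rw [← hBA]
      module
    have e3 := (smul_eq_zero.mp e2).resolve_right hv
    rcases mul_eq_zero.mp e3 with e | e
    · have hc0 := (mul_eq_zero.mp e).resolve_left h2
      rw [hc0, zero_smul] at hcv
      exact hv (inj hcv)
    · rw [e, zero_smul] at e1
      exact hv (inj e1)
  refine ⟨Matrix.GeneralLinearGroup.mkOfDetNeZero _ hdet, ?_, ?_⟩
  · change !![v 0, (A.1 *ᵥ v) 0; v 1, (A.1 *ᵥ v) 1] * !![0, -1; 1, A.1.trace] =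
      A.1 * !![v 0, (A.1 *ᵥ v) 0; v 1, (A.1 *ᵥ v) 1]
    have e : ∀ i, _ := fun i => congrFun hAA i
    have e0 := e 0
    have e1 := e 1
    simp only [Matrix.mulVec, dotProduct, Fin.sum_univ_two, Pi.sub_apply, Pi.smul_apply,
      smul_eq_mul] at e0 e1
    ext i j
    fin_cases i <;> fin_cases j <;>
      simp [Matrix.mul_apply, Fin.sum_univ_two, Matrix.mulVec, dotProduct]
    · linear_combination -e0
    · linear_combination -e1
  · change !![v 0, (A.1 *ᵥ v) 0; v 1, (A.1 *ᵥ v) 1] * !![-s - A.1.trace * r, r; r, s] =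
      B.1 * !![v 0, (A.1 *ᵥ v) 0; v 1, (A.1 *ᵥ v) 1]
    have e0 := congrFun hBA' 0
    have e1 := congrFun hBA' 1
    have d0 := congrFun hB 0
    have d1 := congrFun hB 1
    simp only [Matrix.mulVec, dotProduct, Fin.sum_univ_two, Pi.add_apply, Pi.smul_apply,
      smul_eq_mul] at e0 e1 d0 d1
    ext i j
    fin_cases i <;> fin_cases j <;>
      simp [Matrix.mul_apply, Fin.sum_univ_two, Matrix.mulVec, dotProduct]
    · linear_combination -d0
    · linear_combination -e0
    · linear_combination -d1
    · linear_combination -e1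

end Field

/-! ### Conjugacy and generation over `𝔽_ℓ`. -/

section PrimeField

variable (ℓ : ℕ) [Fact ℓ.Prime]

/-- The square of a commutator is a nontrivial upper unipotent. Its powers fill the upper unipotent
group since the field is prime, and conjugation by the companion matrix yields the lower ones. -/
theorem closure_normalForm (h2 : (2 : ZMod ℓ) ≠ 0) {x r s : ZMod ℓ} (hx : x ≠ 0)
    (h : r ^ 2 + s ^ 2 + x * r * s = -1) :
    Subgroup.closure {companion x, companionMate x r s h} = ⊤ := by
  set H := Subgroup.closure {companion x, companionMate x r s h}
  have hA : companion x ∈ H := Subgroup.subset_closure (by simp)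
  have hB : companionMate x r s h ∈ H := Subgroup.subset_closure (by simp)
  -- With `A` the companion and `B` its mate, `M` is the commutator `A⁻¹B⁻¹AB`, checked in the form
  -- `BAM = AB`.
  obtain ⟨M, hMc⟩ : ∃ M : SL(2, ZMod ℓ), M.1 = !![-1, 2 * x; 0, -1] := ⟨⟨_, by simp⟩, rfl⟩
  have hM : M ∈ H := by
    have e : companionMate x r s h * companion x * M = companion x * companionMate x r s h := by
      ext i j
      fin_cases i <;> fin_cases j <;> simp [hMc, Matrix.mul_apply, Fin.sum_univ_two]
      · ring
      · ring
    rw [← H.mul_mem_cancel_left (H.mul_mem hB hA), e]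
    exact H.mul_mem hA hB
  have hM2 : upperUni (-4 * x) ∈ H := by
    have : upperUni (-4 * x) = M ^ 2 := by
      ext i j
      fin_cases i <;> fin_cases j <;> simp [hMc, pow_two, Matrix.mul_apply, Fin.sum_univ_two]
      ring
    rw [this]
    exact H.pow_mem hM 2
  have h4 : -4 * x ≠ 0 := by
    refine mul_ne_zero ?_ hx
    rw [show (-4 : ZMod ℓ) = -(2 * 2) by norm_num]
    exact neg_ne_zero.mpr (mul_ne_zero h2 h2)
  have hU : ∀ t, upperUni t ∈ H := by
    intro t
    have : upperUni t = upperUni (-4 * x) ^ (t / (-4 * x)).val := by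
      rw [upperUni_pow, ZMod.natCast_zmod_val, div_mul_cancel₀ _ h4]
    rw [this]
    exact H.pow_mem hM2 _
  refine subgroup_eq_top_of_uni H hU fun t => ?_
  rw [← H.mul_mem_cancel_right hA]
  have : lowerUni t * companion x = companion x * upperUni (-t) := by
    ext i j
    fin_cases i <;> fin_cases j <;> simp [Matrix.mul_apply, Fin.sum_univ_two]
  rw [this]
  exact H.mul_mem hA (hU _)

/-- Conjugation by an element of `GL₂(𝔽_ℓ)` is one of the automorphisms of `SL₂(𝔽_ℓ)` given by the
normalizer in `SL₂` of the algebraic closure. -/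
theorem exists_autSL_of_gl (P : GL (Fin 2) (ZMod ℓ)) :
    ∃ σ ∈ autSL ℓ, ∀ A A' : SLl ℓ, P.1 * A.1 = A'.1 * P.1 → σ A = A' := by
  let f := algebraMap (ZMod ℓ) (Kbar ℓ)
  -- Dividing `P` by a square root of its determinant lands in `SL₂` of the closure without changing
  -- the conjugation.
  obtain ⟨δ, hδ⟩ := IsAlgClosed.exists_pow_nat_eq (f P.1.det) (n := 2) (by norm_num)
  have hdet : f P.1.det ≠ 0 := by
    simpa [f] using P.det_ne_zero
  have hδ0 : δ ≠ 0 := by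
    rintro rfl
    rw [zero_pow two_ne_zero] at hδ
    exact hdet hδ.symm
  let g : SL(2, Kbar ℓ) := ⟨δ⁻¹ • P.1.map f, by
    rw [Matrix.det_smul, ← RingHom.mapMatrix_apply, ← RingHom.map_det, ← hδ]
    simp [hδ0]⟩
  have hg : ∀ A A' : SLl ℓ, P.1 * A.1 = A'.1 * P.1 → g * incl ℓ A = incl ℓ A' * g := by
    intro A A' h
    apply Subtype.ext
    change (δ⁻¹ • P.1.map f) * A.1.map f = A'.1.map f * (δ⁻¹ • P.1.map f)
    rw [Matrix.smul_mul, Matrix.mul_smul, ← Matrix.map_mul, ← Matrix.map_mul, h]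
  have hconj : ∀ (Q : GL (Fin 2) (ZMod ℓ)) (A : SLl ℓ), (Q.1 * A.1 * Q⁻¹.1).det = 1 := by
    intro Q A
    have hQ : Q.1.det * Q⁻¹.1.det = 1 := by
      rw [← Matrix.det_mul, ← Units.val_mul, mul_inv_cancel, Units.val_one, Matrix.det_one]
    rw [Matrix.det_mul, Matrix.det_mul, A.2, mul_one, hQ]
  have hmem : g ∈ normSL ℓ := by
    rw [Subgroup.mem_normalizer_iff]
    intro M
    constructor
    · rintro ⟨A, rfl⟩
      refine ⟨⟨_, hconj P A⟩, ?_⟩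
      rw [hg A ⟨_, hconj P A⟩ ?_, mul_inv_cancel_right]
      rw [mul_assoc, ← Units.val_mul, inv_mul_cancel, Units.val_one, mul_one]
    · rintro ⟨A, hA⟩
      refine ⟨⟨_, hconj P⁻¹ A⟩, ?_⟩
      apply mul_left_cancel (a := g)
      rw [hg ⟨_, hconj P⁻¹ A⟩ A ?_, hA, inv_mul_cancel_right]
      change P.1 * (P⁻¹.1 * A.1 * P⁻¹⁻¹.1) = _
      rw [inv_inv, ← mul_assoc, ← mul_assoc, ← Units.val_mul, mul_inv_cancel, Units.val_one,
        one_mul]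
  refine ⟨conjSL ℓ ⟨g, hmem⟩, ⟨_, rfl⟩, fun A A' h => ?_⟩
  apply incl_injective ℓ
  rw [incl_conjSL, hg A A' h, mul_inv_cancel_right]

/-- Shows that `PSL₂(𝔽_ℓ)` is nonabelian for every prime, `ℓ = 2` included. -/
theorem upperUni_mul_lowerUni_ne :
    ((upperUni 1 * lowerUni 1 : SLl ℓ) : PSLl ℓ) ≠ (lowerUni 1 * upperUni 1 : SLl ℓ) := by
  intro h
  rcases sign_of_center ℓ _ _ h with h | h
  · have := congrFun (congrFun h 0) 0
    simp [Matrix.mul_apply, Fin.sum_univ_two] at this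
  · have h0 := congrFun (congrFun h 0) 0
    have h1 := congrFun (congrFun h 0) 1
    simp [Matrix.mul_apply, Fin.sum_univ_two] at h0 h1
    have : (1 : ZMod ℓ) = 0 := by linear_combination h0 - h1
    exact one_ne_zero this

theorem closure_of_surjective {G : Type} [Group G] (φ : Epi G) :
    Subgroup.closure {φ.1 genA, φ.1 genB} = ⊤ := by
  have h : φ.1.range = ⊤ := MonoidHom.range_eq_top.mpr φ.2
  rw [← h, MonoidHom.range_eq_map, ← FreeGroup.closure_range_of, MonoidHom.map_closure]
  congr 1
  ext x
  simp [genA, genB, Fin.exists_fin_two, eq_comm]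

theorem not_commute_of_surjective (φ : Epi (PSLl ℓ)) :
    φ.1 genA * φ.1 genB ≠ φ.1 genB * φ.1 genA := by
  intro h
  have hcomm : ∀ x y : PSLl ℓ, x * y = y * x := by
    have := Subgroup.isMulCommutative_closure (k := {φ.1 genA, φ.1 genB}) (by
      rintro x (rfl | rfl) y (rfl | rfl)
      · rfl
      · exact h
      · exact h.symm
      · rfl)
    rw [closure_of_surjective] at this
    intro x y
    exact congrArg Subtype.val (this.is_comm.comm ⟨x, trivial⟩ ⟨y, trivial⟩)
  exact upperUni_mul_lowerUni_ne ℓ (hcomm (upperUni 1 : SLl ℓ) (lowerUni 1 : SLl ℓ))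

theorem two_ne_zero_zmod (hℓ : 3 ≤ ℓ) : (2 : ZMod ℓ) ≠ 0 := by
  intro h
  have : ((2 : ℕ) : ZMod ℓ) = 0 := by exact_mod_cast h
  rw [ZMod.natCast_eq_zero_iff] at this
  have := Nat.le_of_dvd (by norm_num) this
  omega

theorem trace_commutator_eq_neg_two_iff (A B : SLl ℓ) :
    (A * B * A⁻¹ * B⁻¹).1.trace = -2 ↔
      trTriple ℓ A B 0 ^ 2 + trTriple ℓ A B 1 ^ 2 + trTriple ℓ A B 2 ^ 2 -
        trTriple ℓ A B 0 * trTriple ℓ A B 1 * trTriple ℓ A B 2 = 0 := by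
  rw [trace_commutator]
  change _ ↔ A.1.trace ^ 2 + B.1.trace ^ 2 + (A * B).1.trace ^ 2 -
        A.1.trace * B.1.trace * (A * B).1.trace = 0
  constructor <;> intro h <;> linear_combination h

theorem trTriple_mem_XStar_iff (A B : SLl ℓ) :
    trTriple ℓ A B ∈ XStar ℓ ↔
      (A * B * A⁻¹ * B⁻¹).1.trace = -2 ∧ trTriple ℓ A B ≠ 0 := by
  rw [trace_commutator_eq_neg_two_iff]
  rfl

theorem trTriple_swap (A B : SLl ℓ) :
    trTriple ℓ B A = ![trTriple ℓ A B 1, trTriple ℓ A B 0, trTriple ℓ A B 2] := by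
  ext i
  fin_cases i
  · rfl
  · rfl
  · exact Matrix.trace_mul_comm B.1 A.1

theorem swap_mem_XStar {p : Fin 3 → ZMod ℓ} (h : p ∈ XStar ℓ) : ![p 1, p 0, p 2] ∈ XStar ℓ := by
  refine ⟨?_, ?_⟩
  · have := h.1
    simp only [Matrix.cons_val]
    linear_combination this
  · intro h0
    apply h.2
    ext i
    fin_cases i
    · exact congrFun h0 1
    · exact congrFun h0 0
    · exact congrFun h0 2

/-- If two coordinates vanish, the equation says that the third squares to zero. Hence swapping the
two matrices always reaches the case of nonzero first trace. -/
theorem ne_zero_or_of_mem_XStar {p : Fin 3 → ZMod ℓ} (h : p ∈ XStar ℓ) : p 0 ≠ 0 ∨ p 1 ≠ 0 := by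
  by_contra! h'
  have h1 := h.1
  rw [h'.1, h'.2] at h1
  have h2 : p 2 = 0 := pow_eq_zero_iff two_ne_zero |>.mp (by linear_combination h1)
  apply h.2
  ext i
  fin_cases i
  · exact h'.1
  · exact h'.2
  · exact h2

/-- The Markoff equation divided by `x²`, with `r = -y/x` and `s = z/x`, is the determinant
condition on `companionMate`. -/
theorem normalForm_equation {p : Fin 3 → ZMod ℓ} (h : p ∈ XStar ℓ) (hx : p 0 ≠ 0) :
    (-p 1 / p 0) ^ 2 + (p 2 / p 0) ^ 2 + p 0 * (-p 1 / p 0) * (p 2 / p 0) = -1 := by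
  field_simp
  linear_combination h.1

theorem trTriple_normalForm {p : Fin 3 → ZMod ℓ} (h : p ∈ XStar ℓ) (hx : p 0 ≠ 0) :
    trTriple ℓ (companion (p 0)) (companionMate _ _ _ (normalForm_equation ℓ h hx)) = p := by
  ext i
  fin_cases i <;>
    simp [trTriple, Matrix.trace_fin_two] <;> field_simp
  ring

theorem exists_trTriple_eq {p : Fin 3 → ZMod ℓ} (h : p ∈ XStar ℓ) :
    ∃ A B : SLl ℓ, trTriple ℓ A B = p := by
  rcases ne_zero_or_of_mem_XStar ℓ h with hx | hy
  · exact ⟨_, _, trTriple_normalForm ℓ h hx⟩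
  · obtain ⟨A, B, hAB⟩ : ∃ A B : SLl ℓ, trTriple ℓ A B = ![p 1, p 0, p 2] :=
      ⟨_, _, trTriple_normalForm ℓ (swap_mem_XStar ℓ h) hy⟩
    refine ⟨B, A, ?_⟩
    rw [trTriple_swap, hAB]
    ext i
    fin_cases i <;> rfl

theorem exists_autSL_normalForm (hℓ : 3 ≤ ℓ) {p : Fin 3 → ZMod ℓ} (h : p ∈ XStar ℓ) (hx : p 0 ≠ 0)
    {A B : SLl ℓ} (hAB : trTriple ℓ A B = p) :
    ∃ σ ∈ autSL ℓ, σ (companion (p 0)) = A ∧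
      σ (companionMate _ _ _ (normalForm_equation ℓ h hx)) = B := by
  subst hAB
  have hx' : A.1.trace ≠ 0 := hx
  obtain ⟨P, h1, h2⟩ := exists_conj_normalForm (two_ne_zero_zmod ℓ hℓ) A B
    ((trTriple_mem_XStar_iff ℓ A B).mp h).1 hx' (r := -B.1.trace / A.1.trace)
    (s := (A * B).1.trace / A.1.trace) (by field_simp) (by field_simp)
    (normalForm_equation ℓ h hx)
  obtain ⟨σ, hσ, h3⟩ := exists_autSL_of_gl ℓ P
  exact ⟨σ, hσ, h3 _ _ h1, h3 _ _ h2⟩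

/-- Pairs in `SL₂(𝔽_ℓ)` with the same nonzero traces and commutator trace `-2` are conjugate. -/
theorem exists_autSL_of_trTriple_eq (hℓ : 3 ≤ ℓ) {A B A' B' : SLl ℓ}
    (h : trTriple ℓ A B ∈ XStar ℓ) (h' : trTriple ℓ A' B' = trTriple ℓ A B) :
    ∃ σ ∈ autSL ℓ, σ A = A' ∧ σ B = B' := by
  have key : ∀ {A B A' B' : SLl ℓ}, trTriple ℓ A B ∈ XStar ℓ → trTriple ℓ A' B' = trTriple ℓ A B →
      trTriple ℓ A B 0 ≠ 0 → ∃ σ ∈ autSL ℓ, σ A = A' ∧ σ B = B' := by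
    intro A B A' B' h h' hx
    obtain ⟨σ, hσ, h1, h2⟩ := exists_autSL_normalForm ℓ hℓ h hx rfl
    obtain ⟨τ, hτ, h3, h4⟩ := exists_autSL_normalForm ℓ hℓ h hx h'
    refine ⟨τ * σ⁻¹, Subgroup.mul_mem _ hτ (Subgroup.inv_mem _ hσ), ?_, ?_⟩
    · rw [← h1, ← h3]
      simp
    · rw [← h2, ← h4]
      simp
  rcases ne_zero_or_of_mem_XStar ℓ h with hx | hy
  · exact key h h' hx
  · obtain ⟨σ, hσ, h1, h2⟩ := key (A := B) (B := A) (A' := B') (B' := A')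
      (by rw [trTriple_swap]; exact swap_mem_XStar ℓ h)
      (by rw [trTriple_swap, h', ← trTriple_swap])
      (by rw [trTriple_swap]; exact hy)
    exact ⟨σ, hσ, h2, h1⟩

/-- Pairs in `SL₂(𝔽_ℓ)` with nonzero traces and commutator trace `-2` generate. -/
theorem closure_eq_top_of_mem_XStar (hℓ : 3 ≤ ℓ) {A B : SLl ℓ} (h : trTriple ℓ A B ∈ XStar ℓ) :
    Subgroup.closure {A, B} = ⊤ := by
  have key : ∀ {A B : SLl ℓ}, trTriple ℓ A B ∈ XStar ℓ → trTriple ℓ A B 0 ≠ 0 →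
      Subgroup.closure {A, B} = ⊤ := by
    intro A B h hx
    obtain ⟨σ, -, h1, h2⟩ := exists_autSL_normalForm ℓ hℓ h hx rfl
    have := congrArg (Subgroup.map σ.toMonoidHom) (closure_normalForm ℓ (two_ne_zero_zmod ℓ hℓ) hx
      (normalForm_equation ℓ h hx))
    rw [MonoidHom.map_closure, Set.image_pair,
      Subgroup.map_top_of_surjective _ σ.surjective, MulEquiv.coe_toMonoidHom, h1, h2] at this
    exact this
  rcases ne_zero_or_of_mem_XStar ℓ h with hx | hy
  · exact key h hx
  · rw [Set.pair_comm]
    exact key (by rw [trTriple_swap]; exact swap_mem_XStar ℓ h) (by rw [trTriple_swap]; exact hy)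

/-- If all three traces of a pair vanish, then its image in `PSL₂(𝔽_ℓ)` commutes. -/
theorem commute_of_trTriple_eq_zero {A B : SLl ℓ} (h : trTriple ℓ A B = 0) :
    (A : PSLl ℓ) * (B : PSLl ℓ) = B * A := by
  have h0 : A.1.trace = 0 := congrFun h 0
  have h1 : B.1.trace = 0 := congrFun h 1
  have h2 : (A.1 * B.1).trace = 0 := congrFun h 2
  have h3 := mul_add_mul_eq A.1 B.1
  rw [h0, h1, h2] at h3
  have h4 : A * B = -(B * A) := by
    apply Subtype.ext
    rw [Matrix.SpecialLinearGroup.coe_neg, Matrix.SpecialLinearGroup.coe_mul,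
      Matrix.SpecialLinearGroup.coe_mul]
    apply eq_neg_of_add_eq_zero_left
    simpa using h3
  change ((A * B : SLl ℓ) : PSLl ℓ) = (B * A : SLl ℓ)
  rw [h4, QuotientGroup.eq, Subgroup.mem_center_iff]
  intro g
  rw [inv_neg, neg_mul, inv_mul_cancel]
  simp

/-- The zero triple is excluded because it would make the generators of a nonabelian group commute.
-/
theorem trTriple_mem_XStar_of_surjective (φ : Epi (PSLl ℓ)) {A B : SLl ℓ}
    (hA : (A : PSLl ℓ) = φ.1 genA) (hB : (B : PSLl ℓ) = φ.1 genB)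
    (hc : (A * B * A⁻¹ * B⁻¹).1.trace = -2) : trTriple ℓ A B ∈ XStar ℓ := by
  refine (trTriple_mem_XStar_iff ℓ A B).mpr ⟨hc, fun h => not_commute_of_surjective ℓ φ ?_⟩
  rw [← hA, ← hB]
  exact commute_of_trTriple_eq_zero ℓ h

end PrimeField

end MarkoffFiber

/-! ### Cancellation in free groups -/

namespace FreeGroup

section CommonPrefix

variable {β : Type*} [DecidableEq β]

/-- The length of the longest common prefix of two lists. -/
def commonPrefixLength : List β → List β → ℕ
  | a :: l, b :: m => if a = b then commonPrefixLength l m + 1 else 0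
  | _, _ => 0

/-- Characterises the length by its lower bounds, so that symmetry and the ultrametric inequality
become statements about prefixes. -/
theorem le_commonPrefixLength_iff (n : ℕ) (l m : List β) :
    n ≤ commonPrefixLength l m ↔ ∃ p : List β, p.length = n ∧ p <+: l ∧ p <+: m := by
  induction l generalizing n m with
  | nil => cases n <;> simp [commonPrefixLength]
  | cons a l ih =>
    cases m with
    | nil => cases n <;> simp [commonPrefixLength]
    | cons b m =>
      cases n with
      | zero => simp
      | succ n =>
        by_cases hab : a = b
        · subst hab
          simp only [commonPrefixLength, if_true, Nat.add_le_add_iff_right, ih]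
          constructor
          · rintro ⟨p, rfl, h1, h2⟩
            exact ⟨a :: p, rfl, by simpa using h1, by simpa using h2⟩
          · rintro ⟨p, hp, h1, h2⟩
            cases p with
            | nil => simp at hp
            | cons c p =>
              simp only [List.cons_prefix_cons] at h1 h2
              exact ⟨p, by simpa using hp, h1.2, h2.2⟩
        · simp only [commonPrefixLength, if_neg hab]
          constructor
          · intro h
            omega
          · rintro ⟨p, hp, h1, h2⟩
            cases p with
            | nil => simp at hp
            | cons c p =>
              simp only [List.cons_prefix_cons] at h1 h2
              exact absurd (h1.1.symm.trans h2.1) hab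

end CommonPrefix

variable {α : Type*} [DecidableEq α]

/-- The Gromov product of two elements of a free group, based at the identity: the length of the
longest common prefix of their reduced words. -/
def gromovProduct (x y : FreeGroup α) : ℕ := commonPrefixLength x.toWord y.toWord

theorem exists_prefix_of_le_gromovProduct {x y : FreeGroup α} {n : ℕ}
    (h : n ≤ gromovProduct x y) :
    ∃ p : List (α × Bool), p.length = n ∧ p <+: x.toWord ∧ p <+: y.toWord :=
  (le_commonPrefixLength_iff _ _ _).mp h

theorem gromovProduct_comm (x y : FreeGroup α) : gromovProduct x y = gromovProduct y x :=
  eq_of_forall_le_iff fun n => by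
    simp only [gromovProduct, le_commonPrefixLength_iff]
    exact exists_congr fun p => and_congr_right fun _ => and_comm

/-- The ultrametric inequality: the Cayley graph is a tree. -/
theorem le_gromovProduct_trans {x y z : FreeGroup α} {n : ℕ} (h : n ≤ gromovProduct x y)
    (h' : n ≤ gromovProduct y z) : n ≤ gromovProduct x z := by
  obtain ⟨p, hp, hx, hy⟩ := exists_prefix_of_le_gromovProduct h
  obtain ⟨q, hq, hy', hz⟩ := exists_prefix_of_le_gromovProduct h'
  have : p = q :=
    (List.prefix_of_prefix_length_le hy hy' (by omega)).eq_of_length (by omega)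
  subst this
  exact (le_commonPrefixLength_iff _ _ _).mpr ⟨p, hp, hx, hz⟩

theorem gromovProduct_eq_of_lt {x y z : FreeGroup α}
    (h : gromovProduct y z < gromovProduct x y) : gromovProduct x z = gromovProduct y z := by
  apply le_antisymm
  · by_contra! h'
    have := le_gromovProduct_trans (x := y) (y := x) (z := z) (n := gromovProduct y z + 1)
      (by rw [gromovProduct_comm y x]; omega) (by omega)
    omega
  · exact le_gromovProduct_trans h.le le_rfl

theorem isReduced_invRev {L : List (α × Bool)} (h : IsReduced L) : IsReduced (invRev L) := by
  rw [isReduced_iff_reduce_eq] at h ⊢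
  rw [reduce_invRev, h]

/-- In `x⁻¹y` exactly the common prefix cancels; past it the concatenation is already reduced. -/
theorem norm_inv_mk_mul_mk {l m : List (α × Bool)} (hl : IsReduced l) (hm : IsReduced m) :
    ((mk l)⁻¹ * mk m).norm + 2 * commonPrefixLength l m = l.length + m.length := by
  have norm_mk : ∀ {L : List (α × Bool)}, IsReduced L → (mk L).norm = L.length := by
    intro L hL
    rw [norm, toWord_mk, hL.reduce_eq]
  induction l generalizing m with
  | nil =>
    change ((1 : FreeGroup α)⁻¹ * mk m).norm + 2 * 0 = _
    simp [norm_mk hm]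
  | cons a l ih =>
    cases m with
    | nil =>
      change ((mk (a :: l))⁻¹ * (1 : FreeGroup α)).norm + 2 * 0 = _
      simp only [mul_one, norm_inv_eq, norm_mk hl, mul_zero, add_zero, List.length_nil]
    | cons b m =>
      by_cases hab : a = b
      · subst hab
        have h := ih (hl.infix (List.suffix_cons a l).isInfix)
          (hm.infix (List.suffix_cons a m).isInfix)
        have e : ∀ L : List (α × Bool), mk (a :: L) = mk [a] * mk L := fun L => by simp
        rw [e l, e m, mul_inv_rev, mul_assoc, inv_mul_cancel_left]
        simp only [commonPrefixLength, if_true, List.length_cons]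
        omega
      · have : IsReduced (invRev (a :: l) ++ (b :: m)) := by
          refine List.IsChain.append (isReduced_invRev hl) hm ?_
          intro x hx y hy hxy
          simp only [invRev, List.map_cons, List.reverse_cons, List.getLast?_append,
            List.getLast?_singleton, Option.some_or, Option.mem_some_iff, List.head?_cons] at hx hy
          subst hx hy
          by_contra h
          apply hab
          ext
          · exact hxy
          · simpa using h
        rw [inv_mk, mul_mk, norm_mk this]
        simp [commonPrefixLength, hab]

theorem norm_inv_mul_add (x y : FreeGroup α) :
    (x⁻¹ * y).norm + 2 * gromovProduct x y = x.norm + y.norm := by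
  have := norm_inv_mk_mul_mk (isReduced_toWord (x := x)) (isReduced_toWord (x := y))
  rwa [mk_toWord, mk_toWord] at this

/-- Write `x = c w c⁻¹` with `w` cyclically reduced. Then `|x²| = |x| + |w|`, while the hypothesis
says `|x²| ≤ |x|`; so `w` is empty. -/
theorem eq_one_of_norm_le_two_mul_gromovProduct_inv {x : FreeGroup α}
    (h : x.norm ≤ 2 * gromovProduct x⁻¹ x) : x = 1 := by
  have h1 := norm_inv_mul_add x⁻¹ x
  rw [inv_inv, norm_inv_eq] at h1
  have h2 : (x * x).toWord =
      reduceCyclically.conjugator x.toWord ++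
        (reduceCyclically x.toWord ++ reduceCyclically x.toWord) ++
          invRev (reduceCyclically.conjugator x.toWord) := by
    have := reduceCyclically.reduce_flatten_replicate_succ (isReduced_toWord (x := x)) 1
    rw [toWord_mul]
    simpa [List.replicate_succ] using this
  have h3 := reduceCyclically.conj_conjugator_reduceCyclically x.toWord
  have h4 := congrArg List.length h2
  have h5 := congrArg List.length h3
  simp only [List.length_append] at h4 h5
  change (x * x).norm = _ at h4
  change _ = x.norm at h5
  have h6 : reduceCyclically x.toWord = [] := by
    rw [← List.length_eq_zero_iff]
    omega
  rw [h6, List.append_nil] at h3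
  rw [← mk_toWord (x := x), ← h3, ← mul_mk, ← inv_mk, mul_inv_cancel]

/-- If `u` cancels exactly half against `v` on either side, then a conjugate of `(uv, u)` is shorter
than `(u, v)`. -/
theorem exists_conj_norm_add_lt {u v : FreeGroup α} (hu : u ≠ 1)
    (h : u.norm = 2 * gromovProduct v⁻¹ u) (h' : u.norm = 2 * gromovProduct u⁻¹ v)
    (huv : u.norm ≤ v.norm) :
    ∃ p : FreeGroup α, (p * (u * v) * p⁻¹).norm + (p * u * p⁻¹).norm < u.norm + v.norm := by
  -- The goal is `u = PQ⁻¹` and `v = QWP⁻¹` with `|P| = |Q| = |u|/2`. Conjugation by `P⁻¹` then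
  -- turns `(uv, u)` into `(W, Q⁻¹P)`, of total length at most `|v|`.
  obtain ⟨P, hP, ⟨S, hS⟩, ⟨T, hT⟩⟩ := exists_prefix_of_le_gromovProduct (le_refl (gromovProduct v⁻¹ u))
  obtain ⟨Q, hQ, ⟨S', hS'⟩, ⟨R, hR⟩⟩ :=
    exists_prefix_of_le_gromovProduct (le_refl (gromovProduct u⁻¹ v))
  have hT' : T.length = Q.length := by
    have := congrArg List.length hT
    rw [List.length_append] at this
    change _ = u.norm at this
    omega
  have hQT : Q = invRev T := by
    rw [toWord_inv, ← hT, invRev_append] at hS'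
    exact (List.append_inj hS' (by simp [hT'])).1
  -- Since `|u| ≤ |v|`, the prefix `Q` and the suffix `P⁻¹` of `v` do not overlap.
  have hsuf : invRev P <:+ R := by
    have h1 : invRev P <:+ v.toWord := by
      rw [toWord_inv] at hS
      rw [← invRev_invRev (L₁ := v.toWord), ← hS, invRev_append]
      exact List.suffix_append _ _
    have h2 : R <:+ v.toWord := ⟨Q, hR⟩
    refine List.suffix_of_suffix_length_le h1 h2 ?_
    have := congrArg List.length hR
    rw [List.length_append] at this
    change _ = v.norm at this
    simp only [invRev_length]
    omega
  obtain ⟨W, hW⟩ := hsuf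
  have eu : u = mk P * (mk Q)⁻¹ := by
    rw [hQT, inv_mk, invRev_invRev, mul_mk, hT, mk_toWord]
  have ev : v = mk Q * mk W * (mk P)⁻¹ := by
    rw [inv_mk, mul_mk, mul_mk, List.append_assoc, hW, hR, mk_toWord]
  have lv : Q.length + (W.length + P.length) = v.norm := by
    have := congrArg List.length hR
    rw [← hW] at this
    simpa [norm] using this
  have hu' : u.norm ≠ 0 := fun h0 => hu (norm_eq_zero.mp h0)
  refine ⟨(mk P)⁻¹, ?_⟩
  have e1 : (mk P)⁻¹ * (u * v) * (mk P)⁻¹⁻¹ = mk W := by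
    rw [ev, eu]
    group
  have e2 : (mk P)⁻¹ * u * (mk P)⁻¹⁻¹ = (mk Q)⁻¹ * mk P := by
    rw [eu]
    group
  rw [e1, e2]
  have n1 : (mk W).norm ≤ W.length := norm_mk_le
  have n2 : (mk P).norm ≤ P.length := norm_mk_le
  have n3 : (mk Q).norm ≤ Q.length := norm_mk_le
  have n4 := norm_mul_le (mk Q)⁻¹ (mk P)
  rw [norm_inv_eq] at n4
  omega

theorem mk_flip {β : Type*} (m : β × Bool) : (mk [(m.1, !m.2)] : FreeGroup β) = (mk [m])⁻¹ := by
  simp [inv_mk, invRev]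

/-- A homomorphism of free groups whose values on the letters are Nielsen reduced does not decrease
the word length. -/
theorem norm_le_norm_map {β : Type*} [DecidableEq β] (φ : FreeGroup β →* FreeGroup α)
    (h1 : ∀ l m : β × Bool, l ≠ m →
      2 * gromovProduct (φ (mk [l])) (φ (mk [m])) ≤ (φ (mk [m])).norm)
    (h2 : ∀ l m k : β × Bool, l ≠ m → (m.1, !m.2) ≠ k →
      gromovProduct (φ (mk [l])) (φ (mk [m])) + gromovProduct (φ (mk [m]))⁻¹ (φ (mk [k])) <
        (φ (mk [m])).norm)
    (w : FreeGroup β) : w.norm ≤ (φ w).norm := by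
  have flip_ne : ∀ m : β × Bool, (m.1, !m.2) ≠ m := by
    rintro ⟨i, b⟩
    simp
  -- Cancellation against the next letter sees only the last letter `m`, and each letter contributes
  -- at least one surviving symbol.
  have key : ∀ (L : List (β × Bool)) (m : β × Bool), IsReduced (L ++ [m]) →
      ∀ k, (m.1, !m.2) ≠ k →
        gromovProduct (φ (mk (L ++ [m])))⁻¹ (φ (mk [k])) =
          gromovProduct (φ (mk [m]))⁻¹ (φ (mk [k])) ∧
        gromovProduct (φ (mk [m]))⁻¹ (φ (mk [k])) + L.length + 1 ≤ (φ (mk (L ++ [m]))).norm := by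
    intro L
    induction L using List.reverseRecOn with
    | nil =>
      intro m _ k hk
      refine ⟨rfl, ?_⟩
      have e1 := h2 _ m k (flip_ne m) hk
      have e2 := h1 k (m.1, !m.2) hk.symm
      rw [mk_flip, _root_.map_inv, norm_inv_eq, gromovProduct_comm] at e2
      simp only [List.nil_append, List.length_nil]
      omega
    | append_singleton L j ih =>
      intro m hred k hk
      have hj : IsReduced (L ++ [j]) := hred.infix (List.prefix_append _ _).isInfix
      have hjm : (j.1, !j.2) ≠ m := by
        have : IsReduced [j, m] := hred.infix (by simpa using (List.suffix_append L [j, m]).isInfix)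
        rw [isReduced_cons_cons] at this
        rintro rfl
        simpa using this.1
      obtain ⟨a1, a2⟩ := ih j hj m hjm
      have hg : φ (mk (L ++ [j] ++ [m])) = φ (mk (L ++ [j])) * φ (mk [m]) := by
        rw [← _root_.map_mul, mul_mk]
      have n1 := norm_inv_mul_add (φ (mk (L ++ [j])))⁻¹ (φ (mk [m]))
      have n2 := norm_inv_mul_add (φ (mk (L ++ [j] ++ [m])))⁻¹ (φ (mk [m]))⁻¹
      have n3 := h2 _ m k hjm hk
      rw [mk_flip, _root_.map_inv] at n3
      rw [inv_inv, norm_inv_eq, a1, ← hg] at n1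
      rw [inv_inv, norm_inv_eq, norm_inv_eq] at n2
      rw [show φ (mk (L ++ [j] ++ [m])) * (φ (mk [m]))⁻¹ = φ (mk (L ++ [j])) by
        rw [hg, mul_inv_cancel_right]] at n2
      -- The inverse of the whole product shares with the inverse of its last factor a longer prefix
      -- than the latter shares with the next one, by `h2`.
      refine ⟨gromovProduct_eq_of_lt (y := (φ (mk [m]))⁻¹) (by omega), ?_⟩
      simp only [List.length_append, List.length_singleton]
      omega
  rcases List.eq_nil_or_concat w.toWord with h | ⟨L, m, h⟩
  · simp [norm, h]
  · have h' := (key L m (by rw [← List.concat_eq_append, ← h]; exact isReduced_toWord) m (flip_ne m)).2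
    rw [← List.concat_eq_append, ← h, mk_toWord] at h'
    have : w.norm = L.length + 1 := by simp [norm, h]
    omega

end FreeGroup

/-! ### Generation of `Out(F₂)` -/

namespace MarkoffFiber

open FreeGroup hiding map_inv map_mul norm

/-- The subgroup of `Out(F₂)` generated by the classes of `r`, `s` and `t`. -/
def nielsenSubgroup : Subgroup OutF2 :=
  Subgroup.closure {(autR : OutF2), (autS : OutF2), (autT : OutF2)}

/-- Every automorphism with values `u`, `v` on the basis has class in the subgroup generated by `r`,
`s` and `t`. -/
def NielsenPair (u v : F2) : Prop :=
  ∀ φ : MulAut F2, φ genA = u → φ genB = v → (φ : OutF2) ∈ nielsenSubgroup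

theorem autR_genA : autR genA = genA⁻¹ := by simp [autR, endOf, genA]

theorem autR_genB : autR genB = genB := by simp [autR, endOf, genB]

theorem autS_genA : autS genA = genB := by simp [autS, endOf, genA]

theorem autS_genB : autS genB = genA := by simp [autS, endOf, genB]

theorem autT_genA : autT genA = genA⁻¹ := by simp [autT, endOf, genA]

theorem autT_genB : autT genB = genA * genB := by simp [autT, endOf, genB]

theorem mulAut_ext {φ ψ : MulAut F2} (ha : φ genA = ψ genA) (hb : φ genB = ψ genB) : φ = ψ := by
  apply MulEquiv.toMonoidHom_injective
  ext i
  fin_cases i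
  · exact ha
  · exact hb

/-- Precomposing with a generator performs a Nielsen move on the image of the basis. -/
theorem mem_nielsenSubgroup_of_mul {φ ν : MulAut F2} (hν : (ν : OutF2) ∈ nielsenSubgroup)
    (h : ((φ * ν : MulAut F2) : OutF2) ∈ nielsenSubgroup) : (φ : OutF2) ∈ nielsenSubgroup := by
  rw [QuotientGroup.mk_mul] at h
  exact (Subgroup.mul_mem_cancel_right _ hν).mp h

theorem NielsenPair.of_inv {u v : F2} (h : NielsenPair u⁻¹ v) : NielsenPair u v := by
  intro φ ha hb
  refine mem_nielsenSubgroup_of_mul (ν := autR) (Subgroup.subset_closure (by simp))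
    (h _ ?_ ?_)
  · rw [MulAut.mul_apply, autR_genA, map_inv, ha]
  · rw [MulAut.mul_apply, autR_genB, hb]

theorem NielsenPair.of_swap {u v : F2} (h : NielsenPair v u) : NielsenPair u v := by
  intro φ ha hb
  refine mem_nielsenSubgroup_of_mul (ν := autS) (Subgroup.subset_closure (by simp))
    (h _ ?_ ?_)
  · rw [MulAut.mul_apply, autS_genA, hb]
  · rw [MulAut.mul_apply, autS_genB, ha]

theorem NielsenPair.of_mul {u v : F2} (h : NielsenPair u (u * v)) : NielsenPair u v := by
  intro φ ha hb
  refine mem_nielsenSubgroup_of_mul (ν := autT) (Subgroup.subset_closure (by simp))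
    (NielsenPair.of_inv (u := u⁻¹) (by rwa [inv_inv]) _ ?_ ?_)
  · rw [MulAut.mul_apply, autT_genA, map_inv, ha]
  · rw [MulAut.mul_apply, autT_genB, map_mul, ha, hb]

theorem NielsenPair.of_conj {u v : F2} (p : F2)
    (h : NielsenPair (p * u * p⁻¹) (p * v * p⁻¹)) : NielsenPair u v := by
  intro φ ha hb
  have h1 := h (MulAut.conj p * φ) (by simp [ha]) (by simp [hb])
  have hp : ((MulAut.conj p : MulAut F2) : OutF2) = 1 := (QuotientGroup.eq_one_iff _).mpr ⟨p, rfl⟩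
  rwa [QuotientGroup.mk_mul, hp, one_mul] at h1

theorem NielsenPair.basis : NielsenPair genA genB := by
  intro φ ha hb
  rw [mulAut_ext (φ := φ) (ψ := 1) ha hb]
  exact one_mem _

theorem NielsenPair.of_letters (φ : MulAut F2) (l m : Fin 2 × Bool) (hlm : l.1 ≠ m.1)
    (h : NielsenPair (φ (mk [l])) (φ (mk [m]))) : NielsenPair (φ genA) (φ genB) := by
  have inv : ∀ i : Fin 2, φ (mk [(i, false)]) = (φ (FreeGroup.of i))⁻¹ := by
    intro i
    rw [← map_inv]
    rfl
  have pos : ∀ i : Fin 2, φ (mk [(i, true)]) = φ (FreeGroup.of i) := fun i => rfl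
  obtain ⟨i, b⟩ := l
  obtain ⟨j, c⟩ := m
  have key : NielsenPair (φ (FreeGroup.of i)) (φ (FreeGroup.of j)) := by
    cases b <;> cases c <;> simp only [inv, pos] at h
    · exact NielsenPair.of_inv (NielsenPair.of_swap (NielsenPair.of_inv (NielsenPair.of_swap h)))
    · exact NielsenPair.of_inv h
    · exact NielsenPair.of_swap (NielsenPair.of_inv (NielsenPair.of_swap h))
    · exact h
  fin_cases i <;> fin_cases j
  · exact absurd rfl hlm
  · exact key
  · exact NielsenPair.of_swap key
  · exact absurd rfl hlm

/-- Induction on the total length of the basis image. Failure of `h1` gives a shortening Nielsen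
move, failure of `h2` a shortening up to conjugation; if both hold, `norm_le_norm_map` applies. -/
theorem NielsenPair.all (φ : MulAut F2) : NielsenPair (φ genA) (φ genB) := by
  induction hn : (φ genA).norm + (φ genB).norm using Nat.strong_induction_on generalizing φ with
  | _ n ih =>
  have ih' : ∀ u v : F2, u.norm + v.norm < n → NielsenPair u v := by
    intro u v huv ψ hu hv
    exact ih _ (by rw [← hu, ← hv] at huv; exact huv) ψ rfl ψ rfl rfl
  have norm_letter : ∀ l : Fin 2 × Bool, (φ (mk [l])).norm = (φ (FreeGroup.of l.1)).norm := by
    rintro ⟨i, b⟩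
    cases b
    · rw [← norm_inv_eq, ← map_inv]
      rfl
    · rfl
  have norm_sum : ∀ l m : Fin 2 × Bool, l.1 ≠ m.1 →
      (φ (mk [l])).norm + (φ (mk [m])).norm = n := by
    rintro ⟨i, b⟩ ⟨j, c⟩ hij
    rw [norm_letter, norm_letter, ← hn]
    fin_cases i <;> fin_cases j
    · exact absurd rfl hij
    · rfl
    · exact add_comm _ _
    · exact absurd rfl hij
  have ne_one : ∀ m : Fin 2 × Bool, φ (mk [m]) ≠ 1 := by
    intro m h
    rw [map_eq_one_iff φ φ.injective] at h
    have : (mk [m] : F2).toWord = [] := by rw [h, toWord_one]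
    rw [toWord_mk] at this
    simp at this
  have flip_of : ∀ l m : Fin 2 × Bool, l ≠ m → l.1 = m.1 → l = (m.1, !m.2) := by
    rintro ⟨i, b⟩ ⟨j, c⟩ h h'
    obtain rfl : i = j := h'
    cases b <;> cases c <;> simp at h ⊢
  have sq : ∀ m : Fin 2 × Bool,
      2 * gromovProduct (φ (mk [m]))⁻¹ (φ (mk [m])) < (φ (mk [m])).norm := by
    intro m
    by_contra! h
    exact ne_one m (eq_one_of_norm_le_two_mul_gromovProduct_inv h)
  by_cases h1 : ∀ l m : Fin 2 × Bool, l ≠ m →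
      2 * gromovProduct (φ (mk [l])) (φ (mk [m])) ≤ (φ (mk [m])).norm
  swap
  · push Not at h1
    obtain ⟨l, m, hlm, h⟩ := h1
    by_cases h' : l.1 = m.1
    · rw [flip_of l m hlm h', mk_flip, map_inv] at h
      exact absurd (sq m) (by omega)
    · refine NielsenPair.of_letters φ l m h' (NielsenPair.of_swap (NielsenPair.of_inv
        (NielsenPair.of_mul (ih' _ _ ?_))))
      have e1 := norm_inv_mul_add (φ (mk [m])) (φ (mk [l]))
      have e2 := norm_sum l m h'
      rw [gromovProduct_comm] at e1
      rw [norm_inv_eq]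
      omega
  by_cases h2 : ∀ l m k : Fin 2 × Bool, l ≠ m → (m.1, !m.2) ≠ k →
      gromovProduct (φ (mk [l])) (φ (mk [m])) + gromovProduct (φ (mk [m]))⁻¹ (φ (mk [k])) <
        (φ (mk [m])).norm
  swap
  · push Not at h2
    obtain ⟨l, m, k, hlm, hmk, h⟩ := h2
    have e1 := h1 l m hlm
    have e2 := h1 k (m.1, !m.2) hmk.symm
    rw [mk_flip, map_inv, norm_inv_eq, gromovProduct_comm] at e2
    have hl : l.1 ≠ m.1 := by
      intro h'
      have := sq m
      rw [flip_of l m hlm h', mk_flip, map_inv] at h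
      omega
    have hk : k.1 ≠ m.1 := by
      intro h'
      have hkm : k = m := by
        by_contra hne
        exact hmk (flip_of k m hne h').symm
      have := sq m
      rw [hkm] at h
      omega
    -- Both cancellations are exactly half of `φ(m)`. If `l = k`, then `φ(m)` and its inverse would
    -- share that half, against `sq`; so `l` and `k` are mutually inverse.
    have hlk : l = (k.1, !k.2) := by
      refine flip_of l k ?_ (by omega)
      rintro rfl
      have := le_gromovProduct_trans (x := (φ (mk [m]))⁻¹) (y := φ (mk [l])) (z := φ (mk [m]))
        (n := gromovProduct (φ (mk [l])) (φ (mk [m]))) (by omega) le_rfl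
      have := sq m
      omega
    subst hlk
    rw [mk_flip, map_inv] at h e1
    have e3 := h1 m (k.1, !k.2) hlm.symm
    rw [mk_flip, map_inv, gromovProduct_comm, norm_inv_eq] at e3
    obtain ⟨p, hp⟩ := exists_conj_norm_add_lt (ne_one m) (v := φ (mk [k])) (by omega) (by omega)
      (by omega)
    rw [norm_sum m k hk.symm] at hp
    exact NielsenPair.of_letters φ m k hk.symm
      (NielsenPair.of_mul (NielsenPair.of_swap (NielsenPair.of_conj p (ih' _ _ hp))))
  have hle := norm_le_norm_map φ.toMonoidHom h1 h2
  have preimage : ∀ i : Fin 2, ∃ l, φ (mk [l]) = FreeGroup.of i := by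
    intro i
    -- A basis element has length one, so its preimage is a single letter.
    have h3 := hle (φ.symm (FreeGroup.of i))
    rw [MulEquiv.coe_toMonoidHom, φ.apply_symm_apply, norm_of] at h3
    rcases hw : (φ.symm (FreeGroup.of i)).toWord with _ | ⟨l, _ | ⟨k, L⟩⟩
    · rw [toWord_eq_nil_iff, map_eq_one_iff _ φ.symm.injective] at hw
      exact absurd hw (of_ne_one i)
    · refine ⟨l, ?_⟩
      rw [← hw, mk_toWord, φ.apply_symm_apply]
    · simp [FreeGroup.norm, hw] at h3
  obtain ⟨l, hl⟩ := preimage 0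
  obtain ⟨m, hm⟩ := preimage 1
  refine NielsenPair.of_letters φ l m ?_ (by rw [hl, hm]; exact NielsenPair.basis)
  intro h
  by_cases h' : l = m
  · rw [h', hm] at hl
    exact absurd (of_injective hl) (by decide)
  · rw [flip_of l m h' h, mk_flip, map_inv, hm] at hl
    have := congrArg toWord hl
    simp [toWord_inv, invRev] at this

theorem closure_eq_top : Subgroup.closure {(autR : OutF2), (autS : OutF2), (autT : OutF2)} = ⊤ := by
  rw [eq_top_iff]
  rintro α -
  induction α using QuotientGroup.induction_on with
  | _ φ => exact NielsenPair.all φ φ rfl rfl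

end MarkoffFiber

/-! ### The anti-homomorphism from `Out(F₂)` to the Markoff group -/

namespace MarkoffFiber

open scoped MatrixGroups

section Traces

variable {R : Type} [CommRing R]

/-- The traces of `a`, `b`, `ab` under a representation of `F₂` in `SL₂`. -/
def repTraces (ρ : F2 →* SL(2, R)) : Fin 3 → R :=
  ![(ρ genA).1.trace, (ρ genB).1.trace, (ρ (genA * genB)).1.trace]

theorem trace_mul_mul_inv (A B : SL(2, R)) : (A * B * A⁻¹).1.trace = B.1.trace := by
  rw [Matrix.SpecialLinearGroup.coe_mul, Matrix.trace_mul_comm,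
    ← Matrix.SpecialLinearGroup.coe_mul, inv_mul_cancel_left]

theorem trace_inv (A : SL(2, R)) : A⁻¹.1.trace = A.1.trace := by
  rw [Matrix.SpecialLinearGroup.coe_inv, Matrix.adjugate_fin_two, Matrix.trace_fin_two,
    Matrix.trace_fin_two]
  simp [add_comm]

/-- From `A + A⁻¹ = tr(A)·1`; this is where the Vieta involution comes from. -/
theorem trace_inv_mul (A B : SL(2, R)) :
    (A⁻¹ * B).1.trace = A.1.trace * B.1.trace - (A * B).1.trace := by
  simp only [Matrix.SpecialLinearGroup.coe_mul, Matrix.SpecialLinearGroup.coe_inv,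
    Matrix.adjugate_fin_two, Matrix.trace_fin_two, Matrix.mul_apply, Fin.sum_univ_two,
    Matrix.of_apply, Matrix.cons_val_zero, Matrix.cons_val_one, Matrix.cons_val']
  ring

theorem repTraces_conj (ρ : F2 →* SL(2, R)) (g : F2) :
    repTraces (ρ.comp (MulAut.conj g).toMonoidHom) = repTraces ρ := by
  have : ∀ w, ((ρ.comp (MulAut.conj g).toMonoidHom) w).1.trace = (ρ w).1.trace := by
    intro w
    rw [← trace_mul_mul_inv (ρ g) (ρ w), ← map_mul, ← map_inv, ← map_mul]
    rfl
  simp only [repTraces, this]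

end Traces

/-- An automorphism of `F₂` is realised by an automorphism of `𝔸³` if the latter describes its
effect on the traces of every representation in `SL₂`. -/
def Realises (α : MulAut F2) (γ : AffineAut) : Prop :=
  ∀ (R : Type) [CommRing R] (ρ : F2 →* SL(2, R)),
    repTraces (ρ.comp α.toMonoidHom) = γ • repTraces ρ

/-- Precomposition reverses the order, which makes the resulting map an anti-homomorphism. -/
theorem Realises.mul {α β : MulAut F2} {γ δ : AffineAut} (h : Realises α γ) (h' : Realises β δ) :
    Realises (α * β) (δ * γ) := by
  intro R _ ρ
  rw [mul_smul, ← h, ← h']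
  rfl

theorem Realises.inv {α : MulAut F2} {γ : AffineAut} (h : Realises α γ) :
    Realises α⁻¹ γ⁻¹ := by
  intro R _ ρ
  rw [eq_inv_smul_iff, ← h]
  congr 1
  ext w
  simp

theorem realises_conj (g : F2) : Realises (MulAut.conj g) 1 := by
  intro R _ ρ
  rw [one_smul, repTraces_conj]

theorem realises_autR : Realises autR R3 := by
  intro R _ ρ
  rw [R3_smul]
  ext i
  fin_cases i <;> simp [repTraces, autR_genA, autR_genB, trace_inv, trace_inv_mul,
    -Matrix.SpecialLinearGroup.coe_inv, -Matrix.SpecialLinearGroup.coe_mul]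

theorem realises_autS : Realises autS tau12 := by
  intro R _ ρ
  rw [tau12_smul]
  ext i
  fin_cases i
  · simp [repTraces, autS_genA]
  · simp [repTraces, autS_genB]
  · simp only [repTraces, MonoidHom.comp_apply, MulEquiv.coe_toMonoidHom, map_mul, autS_genA,
      autS_genB]
    exact Matrix.trace_mul_comm (ρ genB).1 (ρ genA).1

theorem realises_autT : Realises autT tau23 := by
  intro R _ ρ
  rw [tau23_smul]
  ext i
  fin_cases i <;> simp [repTraces, autT_genA, autT_genB, trace_inv,
    -Matrix.SpecialLinearGroup.coe_inv, -Matrix.SpecialLinearGroup.coe_mul]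

/-- The automorphisms of `F₂` realised by an element of `Γ`. -/
def realisedSubgroup : Subgroup (MulAut F2) where
  carrier := {α | ∃ γ ∈ Gam, Realises α γ}
  mul_mem' := by
    rintro α β ⟨γ, hγ, h⟩ ⟨δ, hδ, h'⟩
    exact ⟨δ * γ, Gam.mul_mem hδ hγ, h.mul h'⟩
  one_mem' := ⟨1, Gam.one_mem, by simpa using realises_conj 1⟩
  inv_mem' := by
    rintro α ⟨γ, hγ, h⟩
    exact ⟨γ⁻¹, Gam.inv_mem hγ, h.inv⟩

/-- Inner automorphisms are realised by `1`, so generators of `Out(F₂)` suffice. -/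
theorem exists_realises (α : MulAut F2) : ∃ γ ∈ Gam, Realises α γ := by
  have h : realisedSubgroup.map (QuotientGroup.mk' (MulAut.conj : F2 →* MulAut F2).range) = ⊤ := by
    rw [eq_top_iff, ← closure_eq_top, Subgroup.closure_le]
    rintro _ (rfl | rfl | rfl)
    · exact ⟨autR, ⟨R3, R3_mem, realises_autR⟩, rfl⟩
    · exact ⟨autS, ⟨tau12, tau12_mem, realises_autS⟩, rfl⟩
    · exact ⟨autT, ⟨tau23, tau23_mem, realises_autT⟩, rfl⟩
  obtain ⟨β, hβ, hαβ⟩ : (α : OutF2) ∈ realisedSubgroup.map (QuotientGroup.mk' _) :=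
    h ▸ Subgroup.mem_top _
  obtain ⟨w, hw⟩ := QuotientGroup.eq.mp hαβ
  have : α = β * MulAut.conj w := by rw [hw]; group
  rw [this]
  exact realisedSubgroup.mul_mem hβ ⟨1, Gam.one_mem, realises_conj w⟩

theorem exists_repTraces_eq (p : Fin 3 → ℂ) : ∃ ρ : F2 →* SL(2, ℂ), repTraces ρ = p := by
  -- The quadratic is the condition `det B = 1` for the matrix `B` below.
  obtain ⟨w, hw⟩ : ∃ w : ℂ, w * w - p 2 * w + 1 = 0 := by
    obtain ⟨s, hs⟩ := IsAlgClosed.exists_pow_nat_eq (p 2 ^ 2 - 4) (n := 2) (by norm_num)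
    refine ⟨(p 2 + s) / 2, ?_⟩
    linear_combination (1 / 4) * hs
  obtain ⟨A, eA⟩ : ∃ A : SL(2, ℂ), A.1 = !![p 0, -1; 1, 0] := ⟨⟨_, by simp⟩, rfl⟩
  obtain ⟨B, eB⟩ : ∃ B : SL(2, ℂ), B.1 = !![0, w; w - p 2, p 1] :=
    ⟨⟨_, by rw [Matrix.det_fin_two_of]; linear_combination -hw⟩, rfl⟩
  refine ⟨FreeGroup.lift ![A, B], ?_⟩
  have hA : FreeGroup.lift ![A, B] genA = A := by simp [genA]
  have hB : FreeGroup.lift ![A, B] genB = B := by simp [genB]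
  ext i
  fin_cases i <;> simp [repTraces, hA, hB, eA, eB, Matrix.trace_fin_two]

/-- Integer polynomials are determined by their values on `ℂ³`. Together with `exists_repTraces_eq`
this makes realisers unique. -/
theorem eq_of_smul_complex_eq {γ δ : AffineAut} (h : ∀ p : Fin 3 → ℂ, γ • p = δ • p) : γ = δ := by
  have hinj : Function.Injective
      (MvPolynomial.map (algebraMap ℤ ℂ) : MvPolynomial (Fin 3) ℤ → MvPolynomial (Fin 3) ℂ) :=
    MvPolynomial.map_injective _ (RingHom.injective_int _)
  have key : γ.comorphism = δ.comorphism := by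
    apply AlgEquiv.coe_toAlgHom_injective
    ext1 i
    apply hinj
    apply MvPolynomial.funext
    intro p
    have := congrFun (h p) i
    rw [smul_apply, smul_apply, MvPolynomial.aeval_def, MvPolynomial.aeval_def,
      MvPolynomial.eval₂_eq_eval_map, MvPolynomial.eval₂_eq_eval_map] at this
    exact this
  exact unop_injective key

theorem Realises.unique {α : MulAut F2} {γ δ : AffineAut} (h : Realises α γ) (h' : Realises α δ) :
    γ = δ := by
  apply eq_of_smul_complex_eq
  intro p
  obtain ⟨ρ, rfl⟩ := exists_repTraces_eq p
  rw [← h, ← h']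

/-- The element of `Γ` realising an automorphism of `F₂`. -/
noncomputable def realiser (α : MulAut F2) : Gam :=
  ⟨(exists_realises α).choose, (exists_realises α).choose_spec.1⟩

theorem realises_realiser (α : MulAut F2) : Realises α (realiser α) :=
  (exists_realises α).choose_spec.2

theorem realiser_eq {α : MulAut F2} {γ : Gam} (h : Realises α γ) : realiser α = γ :=
  Subtype.ext ((realises_realiser α).unique h)

/-- The anti-homomorphism from `Out(F₂)` to `Γ`. -/
noncomputable def outToGam : OutF2 →* Gamᵐᵒᵖ :=
  QuotientGroup.lift _
    (MonoidHom.mk' (fun α => op (realiser α)) fun α β => by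
      rw [← op_mul]
      exact congrArg op (realiser_eq ((realises_realiser α).mul (realises_realiser β))))
    (by
      rintro _ ⟨g, rfl⟩
      exact congrArg op (realiser_eq (γ := 1) (realises_conj g)))

theorem outToGam_mk (α : MulAut F2) : outToGam (α : OutF2) = op (realiser α) := rfl

theorem outToGam_of_realises {α : MulAut F2} {γ : AffineAut} (hγ : γ ∈ Gam) (h : Realises α γ) :
    outToGam (α : OutF2) = op ⟨γ, hγ⟩ := by
  rw [outToGam_mk, realiser_eq (γ := ⟨γ, hγ⟩) h]

theorem outToGam_surjective : Function.Surjective outToGam := by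
  have key : ∀ γ (hγ : γ ∈ Gam), ∃ α, outToGam α = op ⟨γ, hγ⟩ := by
    intro γ hγ
    induction hγ using Subgroup.closure_induction with
    | mem γ h =>
      rcases h with rfl | rfl | rfl
      · exact ⟨_, outToGam_of_realises _ realises_autR⟩
      · exact ⟨_, outToGam_of_realises _ realises_autS⟩
      · exact ⟨_, outToGam_of_realises _ realises_autT⟩
    | one => exact ⟨1, map_one _⟩
    | mul γ δ hγ hδ h h' =>
      obtain ⟨α, hα⟩ := h
      obtain ⟨β, hβ⟩ := h'
      refine ⟨β * α, ?_⟩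
      rw [map_mul, hα, hβ]
      rfl
    | inv γ hγ h =>
      obtain ⟨α, hα⟩ := h
      refine ⟨α⁻¹, ?_⟩
      rw [map_inv, hα]
      rfl
  intro γ
  obtain ⟨α, hα⟩ := key γ.unop.1 γ.unop.2
  exact ⟨α, hα⟩

/-! ### Invariance of the Markoff equation -/

/-- The transpositions permute a symmetric polynomial, and `R3` replaces `z` by `xy - z`, which
preserves `z² - xyz`. -/
theorem markoff_smul {R : Type} [CommRing R] {γ : AffineAut} (hγ : γ ∈ Gam) (p : Fin 3 → R) :
    (γ • p) 0 ^ 2 + (γ • p) 1 ^ 2 + (γ • p) 2 ^ 2 - (γ • p) 0 * (γ • p) 1 * (γ • p) 2 =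
      p 0 ^ 2 + p 1 ^ 2 + p 2 ^ 2 - p 0 * p 1 * p 2 := by
  induction hγ using Subgroup.closure_induction generalizing p with
  | mem γ h =>
    rcases h with rfl | rfl | rfl
    · rw [R3_smul]
      simp only [Matrix.cons_val]
      ring
    · rw [tau12_smul]
      simp only [Matrix.cons_val]
      ring
    · rw [tau23_smul]
      simp only [Matrix.cons_val]
      ring
  | one => rw [one_smul]
  | mul γ δ _ _ h h' => rw [mul_smul, h, h']
  | inv γ _ h => rw [← h, smul_inv_smul]

theorem smul_zero_of_mem {R : Type} [CommRing R] {γ : AffineAut} (hγ : γ ∈ Gam) :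
    γ • (0 : Fin 3 → R) = 0 := by
  induction hγ using Subgroup.closure_induction with
  | mem γ h =>
    rcases h with rfl | rfl | rfl
    · rw [R3_smul]
      ext i
      fin_cases i <;> simp
    · rw [tau12_smul]
      ext i
      fin_cases i <;> simp
    · rw [tau23_smul]
      ext i
      fin_cases i <;> simp
  | one => rw [one_smul]
  | mul γ δ _ _ h h' => rw [mul_smul, h', h]
  | inv γ _ h => rw [inv_smul_eq_iff, h]

theorem smul_mem_XStar (ℓ : ℕ) [Fact ℓ.Prime] {γ : AffineAut} (hγ : γ ∈ Gam) {p : Fin 3 → ZMod ℓ}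
    (hp : p ∈ XStar ℓ) : γ • p ∈ XStar ℓ := by
  refine ⟨(markoff_smul hγ p).trans hp.1, fun h => hp.2 ?_⟩
  rw [← inv_smul_smul γ p, h, smul_zero_of_mem (Gam.inv_mem hγ)]

end MarkoffFiber

/-! ### The trace maps on `F(ℓ)` and `F̄(ℓ)` -/

namespace MarkoffFiber

section Lifts

variable (ℓ : ℕ)

theorem lift_genA (A B : SLl ℓ) : FreeGroup.lift ![A, B] genA = A := by simp [genA]

theorem lift_genB (A B : SLl ℓ) : FreeGroup.lift ![A, B] genB = B := by simp [genB]

theorem exists_lift_pair (φ : Epi (PSLl ℓ)) :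
    ∃ A B : SLl ℓ, (A : PSLl ℓ) = φ.1 genA ∧ (B : PSLl ℓ) = φ.1 genB := by
  obtain ⟨A, hA⟩ := QuotientGroup.mk_surjective (φ.1 genA)
  obtain ⟨B, hB⟩ := QuotientGroup.mk_surjective (φ.1 genB)
  exact ⟨A, B, hA, hB⟩

theorem mk_neg (A : SLl ℓ) : ((-A : SLl ℓ) : PSLl ℓ) = A := by
  rw [QuotientGroup.eq, Subgroup.mem_center_iff]
  intro g
  rw [inv_neg, neg_mul, inv_mul_cancel]
  simp

end Lifts

section TraceMaps

variable (ℓ : ℕ) [Fact ℓ.Prime]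

theorem repTraces_eq_trTriple (ρ : F2 →* SLl ℓ) :
    repTraces ρ = trTriple ℓ (ρ genA) (ρ genB) := by
  rw [repTraces, trTriple, map_mul]

theorem hom_ext_gen {G : Type*} [Group G] {φ ψ : F2 →* G} (ha : φ genA = ψ genA)
    (hb : φ genB = ψ genB) : φ = ψ := by
  ext i
  fin_cases i
  · exact ha
  · exact hb

theorem mk_eq_of_autSL {φ ψ : Epi (SLl ℓ)} {σ : MulAut (SLl ℓ)} (hσ : σ ∈ autSL ℓ)
    (ha : σ (φ.1 genA) = ψ.1 genA) (hb : σ (φ.1 genB) = ψ.1 genB) :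
    FSL.mk ℓ φ = FSL.mk ℓ ψ := by
  have : ψ.1 = σ.toMonoidHom.comp φ.1 := hom_ext_gen ha.symm hb.symm
  exact Quotient.sound ⟨σ, hσ, fun w => by rw [this]; rfl⟩

theorem bar_mk_eq_of_autPSL {φ ψ : Epi (PSLl ℓ)} {σ : MulAut (PSLl ℓ)} (hσ : σ ∈ autPSL ℓ)
    (ha : σ (φ.1 genA) = ψ.1 genA) (hb : σ (φ.1 genB) = ψ.1 genB) :
    FPSL.mk ℓ φ = FPSL.mk ℓ ψ := by
  have : ψ.1 = σ.toMonoidHom.comp φ.1 := hom_ext_gen ha.symm hb.symm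
  exact Quotient.sound ⟨σ, hσ, fun w => by rw [this]; rfl⟩

theorem Tr_mk (φ : Epi (SLl ℓ)) : Tr ℓ (FSL.mk ℓ φ) = repTraces φ.1 := rfl

theorem TrBar_mk (φ : Epi (PSLl ℓ)) {A B : SLl ℓ} (hA : (A : PSLl ℓ) = φ.1 genA)
    (hB : (B : PSLl ℓ) = φ.1 genB) :
    TrBar ℓ (FPSL.mk ℓ φ) = VQuot.mk ℓ (trTriple ℓ A B) := by
  change trTripleBar ℓ (φ.1 genA) (φ.1 genB) = _
  rw [← hA, ← hB, trTripleBar_mk]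

theorem trInvBar_mk (φ : Epi (PSLl ℓ)) {A B : SLl ℓ} (hA : (A : PSLl ℓ) = φ.1 genA)
    (hB : (B : PSLl ℓ) = φ.1 genB) :
    trInvBar ℓ (FPSL.mk ℓ φ) = (A * B * A⁻¹ * B⁻¹).1.trace := by
  change trCommBar ℓ (φ.1 genA) (φ.1 genB) = _
  rw [← hA, ← hB, trCommBar_mk]

theorem repTraces_mem_XStar (φ : Epi (SLl ℓ)) (h : FSL.mk ℓ φ ∈ FSLm2 ℓ) :
    repTraces φ.1 ∈ XStar ℓ := by
  rw [repTraces_eq_trTriple]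
  exact trTriple_mem_XStar_of_surjective ℓ (projEpi ℓ φ) rfl rfl h

theorem mapsTo_Tr : Set.MapsTo (Tr ℓ) (FSLm2 ℓ) (XStar ℓ) := by
  intro c hc
  induction c using Quotient.inductionOn with
  | _ φ => exact repTraces_mem_XStar ℓ φ hc

theorem mapsTo_TrBar : Set.MapsTo (TrBar ℓ) (FPSLm2 ℓ) (YStar ℓ) := by
  intro d hd
  induction d using Quotient.inductionOn with
  | _ φ =>
    obtain ⟨A, B, hA, hB⟩ := exists_lift_pair ℓ φ
    refine ⟨trTriple ℓ A B, ?_, (TrBar_mk ℓ φ hA hB).symm⟩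
    exact trTriple_mem_XStar_of_surjective ℓ φ hA hB ((trInvBar_mk ℓ φ hA hB).symm.trans hd)

theorem mapsTo_projF : Set.MapsTo (projF ℓ) (FSLm2 ℓ) (FPSLm2 ℓ) := by
  intro c hc
  induction c using Quotient.inductionOn with
  | _ φ => exact hc

theorem mapsTo_mk : Set.MapsTo (VQuot.mk ℓ) (XStar ℓ) (YStar ℓ) :=
  fun p hp => ⟨p, hp, rfl⟩

theorem TrBar_projF (c : FSL ℓ) : TrBar ℓ (projF ℓ c) = VQuot.mk ℓ (Tr ℓ c) := by
  induction c using Quotient.inductionOn with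
  | _ φ =>
    change _ = VQuot.mk ℓ (repTraces φ.1)
    rw [repTraces_eq_trTriple]
    rfl

theorem bijOn_Tr (hℓ : 3 ≤ ℓ) : Set.BijOn (Tr ℓ) (FSLm2 ℓ) (XStar ℓ) := by
  refine ⟨mapsTo_Tr ℓ, ?_, ?_⟩
  · intro c hc d hd h
    induction c using Quotient.inductionOn with
    | _ φ =>
      induction d using Quotient.inductionOn with
      | _ ψ =>
        change repTraces φ.1 = repTraces ψ.1 at h
        have hφ := repTraces_mem_XStar ℓ φ hc
        rw [repTraces_eq_trTriple] at h hφ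
        rw [repTraces_eq_trTriple] at h
        obtain ⟨σ, hσ, ha, hb⟩ := exists_autSL_of_trTriple_eq ℓ hℓ hφ h.symm
        exact mk_eq_of_autSL ℓ hσ ha hb
  · intro p hp
    obtain ⟨A, B, rfl⟩ := exists_trTriple_eq ℓ hp
    have hsurj : Function.Surjective (FreeGroup.lift ![A, B] : F2 →* SLl ℓ) := by
      rw [← MonoidHom.range_eq_top, eq_top_iff, ← closure_eq_top_of_mem_XStar ℓ hℓ hp,
        Subgroup.closure_le]
      rintro _ (rfl | rfl)
      · exact ⟨genA, lift_genA ℓ _ _⟩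
      · exact ⟨genB, lift_genB ℓ _ _⟩
    refine ⟨FSL.mk ℓ ⟨_, hsurj⟩, ?_, ?_⟩
    · change (FreeGroup.lift ![A, B] genA * FreeGroup.lift ![A, B] genB *
        (FreeGroup.lift ![A, B] genA)⁻¹ * (FreeGroup.lift ![A, B] genB)⁻¹).1.trace = -2
      rw [lift_genA, lift_genB]
      exact ((trTriple_mem_XStar_iff ℓ A B).mp hp).1
    · rw [Tr_mk, repTraces_eq_trTriple, lift_genA, lift_genB]

/-- Lifts to `SL₂` can be adjusted by signs so that their traces are any given representative of a
`𝒱`-orbit. -/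
theorem exists_lifts_of_vRel (A B : SLl ℓ) {p : Fin 3 → ZMod ℓ} (h : VRel ℓ (trTriple ℓ A B) p) :
    ∃ A' B' : SLl ℓ, (A' : PSLl ℓ) = A ∧ (B' : PSLl ℓ) = B ∧ trTriple ℓ A' B' = p := by
  rcases h with rfl | rfl | rfl | rfl
  · exact ⟨A, B, rfl, rfl, rfl⟩
  · exact ⟨A, -B, rfl, mk_neg ℓ B, by simp [trTriple]⟩
  · exact ⟨-A, B, mk_neg ℓ A, rfl, by simp [trTriple]⟩
  · exact ⟨-A, -B, mk_neg ℓ A, mk_neg ℓ B, by simp [trTriple]⟩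

theorem bijOn_TrBar (hℓ : 3 ≤ ℓ) : Set.BijOn (TrBar ℓ) (FPSLm2 ℓ) (YStar ℓ) := by
  refine ⟨mapsTo_TrBar ℓ, ?_, ?_⟩
  · intro c hc d hd h
    induction c using Quotient.inductionOn with
    | _ φ =>
      induction d using Quotient.inductionOn with
      | _ ψ =>
        obtain ⟨A, B, hA, hB⟩ := exists_lift_pair ℓ φ
        obtain ⟨A', B', hA', hB'⟩ := exists_lift_pair ℓ ψ
        have hX := trTriple_mem_XStar_of_surjective ℓ φ hA hB
          ((trInvBar_mk ℓ φ hA hB).symm.trans hc)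
        have h' : VQuot.mk ℓ (trTriple ℓ A' B') = VQuot.mk ℓ (trTriple ℓ A B) := by
          rw [← TrBar_mk ℓ φ hA hB, ← TrBar_mk ℓ ψ hA' hB']
          exact h.symm
        -- Changing signs of the lifts of `ψ` makes the triples agree on the nose, so conjugacy in
        -- `SL₂` applies.
        obtain ⟨A'', B'', hA'', hB'', ht⟩ := exists_lifts_of_vRel ℓ A' B' (Quotient.exact h')
        obtain ⟨σ, hσ, rfl, rfl⟩ := exists_autSL_of_trTriple_eq ℓ hℓ hX ht
        refine bar_mk_eq_of_autPSL ℓ (σ := autModCenter _ σ) ⟨σ, hσ, rfl⟩ ?_ ?_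
        · rw [← hA, ← hA', ← hA'']
          rfl
        · rw [← hB, ← hB', ← hB'']
          rfl
  · rintro _ ⟨p, hp, rfl⟩
    obtain ⟨c, hc, rfl⟩ := (bijOn_Tr ℓ hℓ).surjOn hp
    exact ⟨projF ℓ c, mapsTo_projF ℓ hc, TrBar_projF ℓ c⟩

theorem vRel_mem_XStar {p q : Fin 3 → ZMod ℓ} (hp : p ∈ XStar ℓ) (h : VRel ℓ p q) :
    q ∈ XStar ℓ := by
  have h0 : ¬ (p 0 = 0 ∧ p 1 = 0 ∧ p 2 = 0) := by
    rintro ⟨h0, h1, h2⟩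
    apply hp.2
    ext i
    fin_cases i <;> assumption
  have h1 := hp.1
  rw [vRel_iff] at h
  refine ⟨?_, ?_⟩
  · rcases h with ⟨e0, e1, e2⟩ | ⟨e0, e1, e2⟩ | ⟨e0, e1, e2⟩ | ⟨e0, e1, e2⟩ <;>
      rw [e0, e1, e2] <;> linear_combination h1
  · rintro rfl
    apply h0
    simp only [Pi.zero_apply, zero_eq_neg] at h
    grind

/-- The action of `𝒱` on `X*` is free: a fixed point of a nontrivial element has two zero
coordinates, as `ℓ` is odd, and no Markoff point does. -/
theorem ncard_fiber_mk (hℓ : 3 ≤ ℓ) {y : VQuot ℓ} (hy : y ∈ YStar ℓ) :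
    {p ∈ XStar ℓ | VQuot.mk ℓ p = y}.ncard = 4 := by
  obtain ⟨p, hp, rfl⟩ := hy
  have h2 := two_ne_zero_zmod ℓ hℓ
  have eq_zero : ∀ {x : ZMod ℓ}, x = -x → x = 0 := by
    intro x h
    have : 2 * x = 0 := by linear_combination h
    exact (mul_eq_zero.mp this).resolve_left h2
  have hset : {q ∈ XStar ℓ | VQuot.mk ℓ q = VQuot.mk ℓ p} =
      {p, ![p 0, -p 1, -p 2], ![-p 0, p 1, -p 2], ![-p 0, -p 1, p 2]} := by
    ext q
    constructor
    · rintro ⟨-, h⟩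
      exact (Quotient.exact h.symm : VRel ℓ p q)
    · intro h
      have h : VRel ℓ p q := h
      exact ⟨vRel_mem_XStar ℓ hp h, (Quotient.sound h).symm⟩
  have h01 : ¬ (p 0 = 0 ∧ p 1 = 0) := fun h => by
    rcases ne_zero_or_of_mem_XStar ℓ hp with h' | h'
    · exact h' h.1
    · exact h' h.2
  have h12 : ¬ (p 1 = 0 ∧ p 2 = 0) := fun h => h01 ⟨by
    have := hp.1
    rw [h.1, h.2] at this
    exact pow_eq_zero_iff two_ne_zero |>.mp (by linear_combination this), h.1⟩
  have h02 : ¬ (p 0 = 0 ∧ p 2 = 0) := fun h => h01 ⟨h.1, by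
    have := hp.1
    rw [h.1, h.2] at this
    exact pow_eq_zero_iff two_ne_zero |>.mp (by linear_combination this)⟩
  rw [hset, Set.ncard_insert_of_notMem, Set.ncard_insert_of_notMem, Set.ncard_pair]
  · intro h
    exact h12 ⟨eq_zero (congrFun h 1), eq_zero (congrFun h 2).symm⟩
  · rintro (h | h)
    · exact h01 ⟨eq_zero (congrFun h 0), eq_zero (congrFun h 1).symm⟩
    · exact h02 ⟨eq_zero (congrFun h 0), eq_zero (congrFun h 2).symm⟩
  · rintro (h | h | h)
    · exact h12 ⟨eq_zero (congrFun h 1), eq_zero (congrFun h 2)⟩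
    · exact h02 ⟨eq_zero (congrFun h 0), eq_zero (congrFun h 2)⟩
    · exact h01 ⟨eq_zero (congrFun h 0), eq_zero (congrFun h 1)⟩

/-- The count is carried over from `X* → Y*` by the two horizontal bijections. -/
theorem ncard_fiber_projF (hℓ : 3 ≤ ℓ) {d : FPSL ℓ} (hd : d ∈ FPSLm2 ℓ) :
    {c ∈ FSLm2 ℓ | projF ℓ c = d}.ncard = 4 := by
  rw [← ncard_fiber_mk ℓ hℓ (mapsTo_TrBar ℓ hd)]
  have himg : Tr ℓ '' {c ∈ FSLm2 ℓ | projF ℓ c = d} =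
      {p ∈ XStar ℓ | VQuot.mk ℓ p = TrBar ℓ d} := by
    ext p
    constructor
    · rintro ⟨c, ⟨hc, rfl⟩, rfl⟩
      exact ⟨mapsTo_Tr ℓ hc, (TrBar_projF ℓ c).symm⟩
    · rintro ⟨hp, h⟩
      obtain ⟨c, hc, rfl⟩ := (bijOn_Tr ℓ hℓ).surjOn hp
      refine ⟨c, ⟨hc, (bijOn_TrBar ℓ hℓ).injOn (mapsTo_projF ℓ hc) hd ?_⟩, rfl⟩
      rw [TrBar_projF, h]
  rw [← himg, Set.InjOn.ncard_image]
  exact (bijOn_Tr ℓ hℓ).injOn.mono fun c hc => hc.1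

/-! ### Equivariance -/

theorem Tr_smul (α : OutF2) {c : FSL ℓ} (hc : c ∈ FSLm2 ℓ) :
    c <• α ∈ FSLm2 ℓ ∧ Tr ℓ (c <• α) = (unop (outToGam α)) • Tr ℓ c := by
  induction α using QuotientGroup.induction_on with
  | _ β =>
    induction c using Quotient.inductionOn with
    | _ φ =>
      have h := realises_realiser β (ZMod ℓ) φ.1
      refine ⟨?_, h⟩
      change ((φ.1.comp β.toMonoidHom) genA * (φ.1.comp β.toMonoidHom) genB *
        ((φ.1.comp β.toMonoidHom) genA)⁻¹ * ((φ.1.comp β.toMonoidHom) genB)⁻¹).1.trace = -2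
      refine ((trTriple_mem_XStar_iff ℓ _ _).mp ?_).1
      rw [← repTraces_eq_trTriple, h]
      exact smul_mem_XStar ℓ (realiser β).2 (repTraces_mem_XStar ℓ φ hc)

theorem TrBar_smul (α : OutF2) {d : FPSL ℓ} (hd : d ∈ FPSLm2 ℓ) :
    d <• α ∈ FPSLm2 ℓ ∧ TrBar ℓ (d <• α) = (unop (outToGam α)) • TrBar ℓ d := by
  induction α using QuotientGroup.induction_on with
  | _ β =>
    induction d using Quotient.inductionOn with
    | _ φ =>
      obtain ⟨A, B, hA, hB⟩ := exists_lift_pair ℓ φ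
      have hX := trTriple_mem_XStar_of_surjective ℓ φ hA hB
        ((trInvBar_mk ℓ φ hA hB).symm.trans hd)
      -- Freeness lifts `φ` to `SL₂`; `Realises` holds for every representation, so `ρ` need not be
      -- shown surjective.
      obtain ⟨ρ, rfl, rfl⟩ : ∃ ρ : F2 →* SLl ℓ, ρ genA = A ∧ ρ genB = B :=
        ⟨_, lift_genA ℓ A B, lift_genB ℓ A B⟩
      have hρ : (QuotientGroup.mk' _).comp ρ = φ.1 := hom_ext_gen hA hB
      have h := realises_realiser β (ZMod ℓ) ρ
      have hA' : ((ρ.comp β.toMonoidHom) genA : PSLl ℓ) = (Epi.precomp φ β).1 genA := by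
        change (QuotientGroup.mk' _).comp ρ (β genA) = φ.1 (β genA)
        rw [hρ]
      have hB' : ((ρ.comp β.toMonoidHom) genB : PSLl ℓ) = (Epi.precomp φ β).1 genB := by
        change (QuotientGroup.mk' _).comp ρ (β genB) = φ.1 (β genB)
        rw [hρ]
      constructor
      · refine (trInvBar_mk ℓ (Epi.precomp φ β) hA' hB').trans
          ((trTriple_mem_XStar_iff ℓ _ _).mp ?_).1
        rw [← repTraces_eq_trTriple, h]
        rw [← repTraces_eq_trTriple] at hX
        exact smul_mem_XStar ℓ (realiser β).2 hX
      · refine (TrBar_mk ℓ (Epi.precomp φ β) hA' hB').trans ?_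
        change _ = realiser β • TrBar ℓ (FPSL.mk ℓ φ)
        rw [TrBar_mk ℓ φ hA hB, smul_vQuot_mk, ← repTraces_eq_trTriple, ← repTraces_eq_trTriple, h]
        rfl

/-! ### Emptiness and nonemptiness -/

theorem XStar_three : XStar 3 = ∅ := by
  have key : ∀ x y z : ZMod 3, x ^ 2 + y ^ 2 + z ^ 2 - x * y * z = 0 → x = 0 ∧ y = 0 ∧ z = 0 := by
    decide
  rw [Set.eq_empty_iff_forall_notMem]
  rintro p ⟨h, h0⟩
  apply h0
  obtain ⟨h1, h2, h3⟩ := key _ _ _ h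
  ext i
  fin_cases i <;> assumption

theorem three_mem_XStar (hℓ : 5 ≤ ℓ) : ![3, 3, 3] ∈ XStar ℓ := by
  refine ⟨?_, fun h => ?_⟩
  · simp only [Matrix.cons_val]
    ring
  · have h3 : ((3 : ℕ) : ZMod ℓ) = 0 := by exact_mod_cast congrFun h 0
    rw [ZMod.natCast_eq_zero_iff] at h3
    have := Nat.le_of_dvd (by norm_num) h3
    omega

-- Over `𝔽₂` an exhaustive check of matrix entries shows that such pairs commute, hence cannot
-- generate `PSL₂(𝔽₂)`.
set_option synthInstance.maxHeartbeats 400000 in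
set_option synthInstance.maxSize 1000 in
set_option maxRecDepth 100000 in
theorem commute_of_trace_commutator_two {A B : SLl 2}
    (h : (A * B * A⁻¹ * B⁻¹).1.trace = -2) : (A : PSLl 2) * (B : PSLl 2) = B * A := by
  have key : ∀ a b c d e f g k : ZMod 2, a * d - b * c = 1 → e * k - f * g = 1 →
      (a + d) ^ 2 + (e + k) ^ 2 + (a * e + b * g + (c * f + d * k)) ^ 2 -
        (a + d) * (e + k) * (a * e + b * g + (c * f + d * k)) = 0 →
      a * e + b * g = e * a + f * c ∧ a * f + b * k = e * b + f * d ∧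
      c * e + d * g = g * a + k * c ∧ c * f + d * k = g * b + k * d := by
    decide
  have hA := A.2
  have hB := B.2
  rw [Matrix.det_fin_two] at hA hB
  rw [trace_commutator_eq_neg_two_iff] at h
  simp only [trTriple, Matrix.cons_val, Matrix.SpecialLinearGroup.coe_mul, Matrix.trace_fin_two,
    Matrix.mul_apply, Fin.sum_univ_two] at h
  obtain ⟨h1, h2, h3, h4⟩ := key _ _ _ _ _ _ _ _ hA hB h
  have hAB : A * B = B * A := by
    ext i j
    rw [Matrix.SpecialLinearGroup.coe_mul, Matrix.SpecialLinearGroup.coe_mul, Matrix.mul_apply,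
      Matrix.mul_apply, Fin.sum_univ_two, Fin.sum_univ_two]
    fin_cases i <;> fin_cases j <;> assumption
  exact congrArg (QuotientGroup.mk' _) hAB

theorem FPSLm2_two : FPSLm2 2 = ∅ := by
  rw [Set.eq_empty_iff_forall_notMem]
  intro d hd
  induction d using Quotient.inductionOn with
  | _ φ =>
    obtain ⟨A, B, hA, hB⟩ := exists_lift_pair 2 φ
    apply not_commute_of_surjective 2 φ
    rw [← hA, ← hB]
    exact commute_of_trace_commutator_two ((trInvBar_mk 2 φ hA hB).symm.trans hd)

theorem FSLm2_two : FSLm2 2 = ∅ := by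
  rw [Set.eq_empty_iff_forall_notMem]
  intro c hc
  have := mapsTo_projF 2 hc
  rw [FPSLm2_two] at this
  exact this

theorem XStar_two_nonempty : (XStar 2).Nonempty := by
  refine ⟨![1, 1, 0], ?_, fun h => ?_⟩
  · decide
  · exact one_ne_zero (congrFun h 0)

end TraceMaps

end MarkoffFiber

theorem mainTheorem7 :
    -- for primes at least 3, the trace maps restrict to a commutative square of bijections,
    -- and the vertical maps are four-to-one
    (∀ (ℓ : ℕ) [Fact ℓ.Prime], 3 ≤ ℓ →
      Set.MapsTo (projF ℓ) (FSLm2 ℓ) (FPSLm2 ℓ) ∧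
      Set.MapsTo (VQuot.mk ℓ) (XStar ℓ) (YStar ℓ) ∧
      (∀ c ∈ FSLm2 ℓ, TrBar ℓ (projF ℓ c) = VQuot.mk ℓ (Tr ℓ c)) ∧
      Set.BijOn (Tr ℓ) (FSLm2 ℓ) (XStar ℓ) ∧
      Set.BijOn (TrBar ℓ) (FPSLm2 ℓ) (YStar ℓ) ∧
      (∀ d ∈ FPSLm2 ℓ, {c ∈ FSLm2 ℓ | projF ℓ c = d}.ncard = 4) ∧
      (∀ y ∈ YStar ℓ, {p ∈ XStar ℓ | VQuot.mk ℓ p = y}.ncard = 4)) ∧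
    -- `Out(F₂)` is generated by the classes of `r`, `s`, `t`
    Subgroup.closure {(autR : OutF2), (autS : OutF2), (autT : OutF2)} = ⊤ ∧
    -- there is an anti-homomorphism from `Out(F₂)` onto `Γ`, with `r ↦ R₃`, `s ↦ τ₁₂`, `t ↦ τ₂₃`,
    -- through which the right action of `Out(F₂)` becomes the left action of `Γ`
    (∃ Θ : OutF2 →* Gamᵐᵒᵖ,
      Function.Surjective Θ ∧
      Θ (autR : OutF2) = op ⟨R3, R3_mem⟩ ∧
      Θ (autS : OutF2) = op ⟨tau12, tau12_mem⟩ ∧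
      Θ (autT : OutF2) = op ⟨tau23, tau23_mem⟩ ∧
      ∀ (ℓ : ℕ) [Fact ℓ.Prime], 3 ≤ ℓ →
        (∀ γ : Gam, Set.MapsTo (fun p => γ • p) (XStar ℓ) (XStar ℓ)) ∧
        (∀ γ : Gam, Set.MapsTo (fun y => γ • y) (YStar ℓ) (YStar ℓ)) ∧
        (∀ α : OutF2, ∀ c ∈ FSLm2 ℓ,
          c <• α ∈ FSLm2 ℓ ∧ Tr ℓ (c <• α) = (unop (Θ α)) • Tr ℓ c) ∧
        (∀ α : OutF2, ∀ d ∈ FPSLm2 ℓ,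
          d <• α ∈ FPSLm2 ℓ ∧ TrBar ℓ (d <• α) = (unop (Θ α)) • TrBar ℓ d)) ∧
    -- emptiness and nonemptiness
    (FSLm2 3 = ∅ ∧ FPSLm2 3 = ∅ ∧ XStar 3 = ∅ ∧ YStar 3 = ∅) ∧
    (∀ (ℓ : ℕ) [Fact ℓ.Prime], 5 ≤ ℓ →
      (FSLm2 ℓ).Nonempty ∧ (FPSLm2 ℓ).Nonempty ∧ (XStar ℓ).Nonempty ∧ (YStar ℓ).Nonempty) ∧
    (FSLm2 2 = ∅ ∧ FPSLm2 2 = ∅ ∧ (XStar 2).Nonempty ∧ (YStar 2).Nonempty) := by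
  refine ⟨?_, closure_eq_top, ⟨outToGam, outToGam_surjective, outToGam_of_realises _ realises_autR,
    outToGam_of_realises _ realises_autS, outToGam_of_realises _ realises_autT, ?_⟩, ?_, ?_, ?_⟩
  · intro ℓ _ hℓ
    exact ⟨mapsTo_projF ℓ, mapsTo_mk ℓ, fun c _ => TrBar_projF ℓ c, bijOn_Tr ℓ hℓ, bijOn_TrBar ℓ hℓ,
      fun d hd => ncard_fiber_projF ℓ hℓ hd, fun y hy => ncard_fiber_mk ℓ hℓ hy⟩
  · intro ℓ _ hℓ
    refine ⟨fun γ p hp => smul_mem_XStar ℓ γ.2 hp, ?_, fun α c hc => Tr_smul ℓ α hc,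
      fun α d hd => TrBar_smul ℓ α hd⟩
    rintro γ _ ⟨p, hp, rfl⟩
    exact ⟨γ • p, smul_mem_XStar ℓ γ.2 hp, rfl⟩
  · have hY : YStar 3 = ∅ := by rw [YStar, XStar_three, Set.image_empty]
    refine ⟨?_, ?_, XStar_three, hY⟩
    · have := (bijOn_Tr 3 le_rfl).image_eq
      rwa [XStar_three, Set.image_eq_empty] at this
    · have := (bijOn_TrBar 3 le_rfl).image_eq
      rwa [hY, Set.image_eq_empty] at this
  · intro ℓ _ hℓ
    have hX : (XStar ℓ).Nonempty := ⟨_, three_mem_XStar ℓ hℓ⟩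
    have hF : (FSLm2 ℓ).Nonempty := by
      rw [← (bijOn_Tr ℓ (by omega)).image_eq] at hX
      exact hX.of_image
    exact ⟨hF, (hF.image _).mono (mapsTo_projF ℓ).image_subset, hX, hX.image _⟩
  · exact ⟨FSLm2_two, FPSLm2_two, XStar_two_nonempty, XStar_two_nonempty.image _⟩
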